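/- Let $t,s_1,s_2,s_3,r_1,r_2\in\mathbb{C}$ with $t\neq 0,1$ and $r_1+r_2=s_1+s_2+s_3-1$, and assume that none of $s_1$, $r_1+r_2-s_1-s_3+1=s_2$, $r_1+r_2-s_1+1=s_2+s_3$ is a nonpositive integer. Consider the Heun operator $$D_x=x(x-1)(x-t)\frac{d^2}{dx^2}+x(x-1)(x-t)\Big(\frac{s_1}{x}+\frac{s_2}{x-1}+\frac{s_3}{x-t}\Big)\frac{d}{dx}+r_1r_2x+\lambda .$$ Let $f_\lambda(x)=\sum_{i\ge 0}P_i(\lambda)x^i$ be the unique power series solution of $D_xf_\lambda=0$ with $f_\lambda(0)=1$; each $P_i$ is a polynomial of degree $i$ in $\lambda$, so $(P_i)_{i\ge0}$ is a basis of $\mathbb{C}[\lambda]$. Define $C_{i,j}^k\in\mathbb{C}$ by $P_i(\lambda)P_j(\lambda)=\sum_{k}C_{i,j}^kP_k(\lambda)$ and put $$K(x_1,x_2,y)=\sum_{i,j,k\ge0}C_{i,j}^k\frac{x_1^ix_2^j}{y^{k+1}} .$$ Let $F(a,b,c,u)=\sum_{n\ge0}\frac{(a)_n(b)_n}{(c)_n}\frac{u^n}{n!}$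 be the Gauss hypergeometric function, where $(a)_n=a(a+1)\cdots(a+n-1)$. Then there are $\rho>0$ and $R>0$, depending only on the parameters $t,s_1,s_2,s_3,r_1,r_2$, such that for all $x_1,x_2,y\in\mathbb{C}$ with $|x_1|<\rho$, $|x_2|<\rho$, $|y|>R$ we have $|x_1x_2|<|t|$ and $|t-1|<|y-1|$, the series defining $K(x_1,x_2,y)$ converges absolutely, and $$K(x_1,x_2,y)=\frac{1}{y-1}\sum_{i=0}^{\infty}\frac{(r_1+r_2-s_1-s_3+1)\cdots(r_1+r_2-s_1-s_3+i)}{(r_1+r_2-s_1+i)\cdots(r_1+r_2-s_1+2i-1)}$$ $$\times F\Big(i+1,\,r_1+r_2-s_1-s_3+i+1,\,r_1+r_2-s_1+2i+1,\,\frac{t-1}{y-1}\Big)$$ $$\times F\Big(-i,\,r_1+r_2-s_1+i,\,r_1+r_2-s_1-s_3+1,\,\frac{t(x_1-1)(x_2-1)}{(t-1)(x_1x_2-t)}\Big)$$ $$\times F\Big(r_1+i,\,r_2+i,\,s_1,\,\frac{x_1x_2}{t}\Big)\Big(\frac{x_1x_2}{t}-1\Big)^i\frac{(t-1)^i}{(y-1)^i},$$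 where the series over $i$ converges absolutely and, for $i=0$, the empty products in the first fraction equal $1$. -/

import Mathlib

noncomputable section

namespace Heun

/-- The Heun operator
`x(x-1)(x-t) d²/dx² + x(x-1)(x-t) (s₁/x + s₂/(x-1) + s₃/(x-t)) d/dx + r₁ r₂ x + lam`
acting on power series in `x`. -/
def heunOperator (t s₁ s₂ s₃ r₁ r₂ lam : ℂ) (f : PowerSeries ℂ) : PowerSeries ℂ :=
  PowerSeries.X * (PowerSeries.X - 1) * (PowerSeries.X - PowerSeries.C t) *
      PowerSeries.derivative ℂ (PowerSeries.derivative ℂ f) +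
    (PowerSeries.C s₁ * (PowerSeries.X - 1) * (PowerSeries.X - PowerSeries.C t) +
      PowerSeries.C s₂ * PowerSeries.X * (PowerSeries.X - PowerSeries.C t) +
      PowerSeries.C s₃ * PowerSeries.X * (PowerSeries.X - 1)) * PowerSeries.derivative ℂ f +
    (PowerSeries.C (r₁ * r₂) * PowerSeries.X + PowerSeries.C lam) * f

/-- The polynomials `P_i(lam)`, the coefficients of the normalized power series solution of
`heunOperator f = 0`. That they are these coefficients, and that the normalized solution is unique,
is `heunOperator_eq_zero_iff` below. The polynomial variable is the accessory parameter `lam`. -/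
def heunPoly (t s₁ s₂ s₃ r₁ r₂ : ℂ) : ℕ → Polynomial ℂ
  | 0 => 1
  | 1 => Polynomial.C (t * s₁)⁻¹ * (-Polynomial.X)
  | n + 2 =>
    Polynomial.C (t * ((n : ℂ) + 2) * ((n : ℂ) + 1 + s₁))⁻¹ *
      ((Polynomial.C ((1 + t) * ((n : ℂ) + 1) * n +
            (s₁ * (1 + t) + s₂ * t + s₃) * ((n : ℂ) + 1)) - Polynomial.X) *
          heunPoly t s₁ s₂ s₃ r₁ r₂ (n + 1) -
        Polynomial.C ((n : ℂ) * ((n : ℂ) - 1) + (s₁ + s₂ + s₃) * n + r₁ * r₂) *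
          heunPoly t s₁ s₂ s₃ r₁ r₂ n)

theorem heunOperator_expand (t s₁ s₂ s₃ r₁ r₂ lam : ℂ) (f : PowerSeries ℂ) :
    heunOperator t s₁ s₂ s₃ r₁ r₂ lam f =
      PowerSeries.X ^ 3 * PowerSeries.derivative ℂ (PowerSeries.derivative ℂ f) -
      PowerSeries.C (1 + t) *
        (PowerSeries.X ^ 2 * PowerSeries.derivative ℂ (PowerSeries.derivative ℂ f)) +
      PowerSeries.C t *
        (PowerSeries.X ^ 1 * PowerSeries.derivative ℂ (PowerSeries.derivative ℂ f)) +
      PowerSeries.C (s₁ + s₂ + s₃) * (PowerSeries.X ^ 2 * PowerSeries.derivative ℂ f) -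
      PowerSeries.C (s₁ * (1 + t) + s₂ * t + s₃) *
        (PowerSeries.X ^ 1 * PowerSeries.derivative ℂ f) +
      PowerSeries.C (s₁ * t) * PowerSeries.derivative ℂ f +
      PowerSeries.C (r₁ * r₂) * (PowerSeries.X ^ 1 * f) + PowerSeries.C lam * f := by
  simp only [heunOperator, map_add, map_mul, map_one]
  ring

theorem coeff_zero_heunOperator (t s₁ s₂ s₃ r₁ r₂ lam : ℂ) (f : PowerSeries ℂ) :
    PowerSeries.coeff 0 (heunOperator t s₁ s₂ s₃ r₁ r₂ lam f) =
      t * s₁ * PowerSeries.coeff 1 f + lam * PowerSeries.coeff 0 f := by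
  rw [heunOperator_expand]
  generalize s₁ * (1 + t) + s₂ * t + s₃ = c
  generalize s₁ + s₂ + s₃ = b
  generalize 1 + t = a
  simp only [map_add, map_sub, PowerSeries.coeff_C_mul, PowerSeries.coeff_X_pow_mul',
    PowerSeries.coeff_derivative]
  norm_num
  ring_nf
  simp

theorem coeff_succ_heunOperator (t s₁ s₂ s₃ r₁ r₂ lam : ℂ) (f : PowerSeries ℂ) (n : ℕ) :
    PowerSeries.coeff (n + 1) (heunOperator t s₁ s₂ s₃ r₁ r₂ lam f) =
      t * ((n : ℂ) + 2) * ((n : ℂ) + 1 + s₁) * PowerSeries.coeff (n + 2) f -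
      ((1 + t) * ((n : ℂ) + 1) * n + (s₁ * (1 + t) + s₂ * t + s₃) * ((n : ℂ) + 1) - lam) *
        PowerSeries.coeff (n + 1) f +
      ((n : ℂ) * ((n : ℂ) - 1) + (s₁ + s₂ + s₃) * n + r₁ * r₂) * PowerSeries.coeff n f := by
  rw [heunOperator_expand]
  generalize s₁ * (1 + t) + s₂ * t + s₃ = c
  generalize s₁ + s₂ + s₃ = b
  generalize 1 + t = a
  simp only [map_add, map_sub, PowerSeries.coeff_C_mul, PowerSeries.coeff_X_pow_mul',
    PowerSeries.coeff_derivative]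
  rcases n with _ | _ | n
  · norm_num
    ring
  · norm_num
    ring
  · have h1 : 3 ≤ n + 1 + 1 + 1 := by omega
    have h2 : 2 ≤ n + 1 + 1 + 1 := by omega
    have h3 : 1 ≤ n + 1 + 1 + 1 := by omega
    have e1 : n + 1 + 1 + 1 - 3 = n := by omega
    have e2 : n + 1 + 1 + 1 - 2 = n + 1 := by omega
    have e3 : n + 1 + 1 + 1 - 1 = n + 2 := by omega
    simp only [h1, h2, h3, if_true, e1, e2, e3]
    push_cast
    ring

/-- If `s₁` is not a nonpositive integer, the series `∑ P_i(lam) x^i` is the unique power series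
`f` with `f(0) = 1` that solves the Heun equation. -/
theorem heunOperator_eq_zero_iff {t s₁ : ℂ} (s₂ s₃ r₁ r₂ lam : ℂ) (ht : t ≠ 0)
    (hs₁ : ∀ n : ℕ, s₁ ≠ -(n : ℂ)) (f : PowerSeries ℂ) :
    (heunOperator t s₁ s₂ s₃ r₁ r₂ lam f = 0 ∧ PowerSeries.constantCoeff f = 1) ↔
      f = PowerSeries.mk fun i => (heunPoly t s₁ s₂ s₃ r₁ r₂ i).eval lam := by
  have h0 : s₁ ≠ 0 := by simpa using hs₁ 0
  have h1 : ∀ n : ℕ, (n : ℂ) + 1 + s₁ ≠ 0 := fun n h => hs₁ (n + 1) (by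
    push_cast
    linear_combination h)
  have h2 : ∀ n : ℕ, (n : ℂ) + 2 ≠ 0 := fun n => by exact_mod_cast (by omega : n + 2 ≠ 0)
  constructor
  · rintro ⟨hf, hc⟩
    have key : ∀ n, PowerSeries.coeff n f = (heunPoly t s₁ s₂ s₃ r₁ r₂ n).eval lam ∧
        PowerSeries.coeff (n + 1) f = (heunPoly t s₁ s₂ s₃ r₁ r₂ (n + 1)).eval lam := by
      intro n
      induction n with
      | zero =>
        have hc' : PowerSeries.coeff 0 f = 1 := by simpa using hc
        refine ⟨by simp [heunPoly, hc], ?_⟩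
        have h := coeff_zero_heunOperator t s₁ s₂ s₃ r₁ r₂ lam f
        rw [hf, hc'] at h
        simp only [map_zero] at h
        simp only [zero_add, heunPoly, Polynomial.eval_mul, Polynomial.eval_C,
          Polynomial.eval_neg, Polynomial.eval_X]
        field_simp
        linear_combination -h
      | succ n ih =>
        refine ⟨ih.2, ?_⟩
        have h := coeff_succ_heunOperator t s₁ s₂ s₃ r₁ r₂ lam f n
        rw [hf, ih.1, ih.2] at h
        simp only [map_zero] at h
        have h1n := h1 n
        have h2n := h2 n
        rw [heunPoly]
        simp only [Polynomial.eval_mul, Polynomial.eval_C, Polynomial.eval_sub, Polynomial.eval_X]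
        rw [← mul_right_inj' (mul_ne_zero (mul_ne_zero ht h2n) h1n), ← mul_assoc _ _⁻¹,
          mul_inv_cancel₀ (mul_ne_zero (mul_ne_zero ht h2n) h1n)]
        linear_combination -h
    ext n
    rw [PowerSeries.coeff_mk]
    exact (key n).1
  · rintro rfl
    refine ⟨?_, by simp [← PowerSeries.coeff_zero_eq_constantCoeff_apply, heunPoly]⟩
    ext n
    rcases n with _ | n
    · rw [coeff_zero_heunOperator]
      simp only [PowerSeries.coeff_mk, heunPoly, Polynomial.eval_mul, Polynomial.eval_C,
        Polynomial.eval_neg, Polynomial.eval_X, Polynomial.eval_one, map_zero]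
      field_simp
      ring
    · rw [coeff_succ_heunOperator]
      have h1n := h1 n
      have h2n := h2 n
      simp only [PowerSeries.coeff_mk, map_zero]
      rw [heunPoly]
      simp only [Polynomial.eval_mul, Polynomial.eval_C, Polynomial.eval_sub, Polynomial.eval_X]
      rw [← mul_assoc _ _⁻¹, mul_inv_cancel₀ (mul_ne_zero (mul_ne_zero ht h2n) h1n)]
      ring

theorem degree_heunPoly {t s₁ : ℂ} (s₂ s₃ r₁ r₂ : ℂ) (ht : t ≠ 0)
    (hs₁ : ∀ n : ℕ, s₁ ≠ -(n : ℂ)) (i : ℕ) : (heunPoly t s₁ s₂ s₃ r₁ r₂ i).degree = i := by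
  have h0 : s₁ ≠ 0 := by simpa using hs₁ 0
  have h1 : ∀ n : ℕ, (n : ℂ) + 1 + s₁ ≠ 0 := fun n h => hs₁ (n + 1) (by
    push_cast
    linear_combination h)
  have h2 : ∀ n : ℕ, (n : ℂ) + 2 ≠ 0 := fun n => by exact_mod_cast (by omega : n + 2 ≠ 0)
  have key : ∀ n : ℕ, (heunPoly t s₁ s₂ s₃ r₁ r₂ n).degree = n ∧
      (heunPoly t s₁ s₂ s₃ r₁ r₂ (n + 1)).degree = (n + 1 : ℕ) := by
    intro n
    induction n with
    | zero =>
      constructor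
      · simp [heunPoly]
      · have : (t * s₁)⁻¹ ≠ 0 := inv_ne_zero (mul_ne_zero ht h0)
        rw [zero_add, heunPoly, Polynomial.degree_mul, Polynomial.degree_C this,
          Polynomial.degree_neg, Polynomial.degree_X]
        rfl
    | succ n ih =>
      refine ⟨ih.2, ?_⟩
      have hc : (t * ((n : ℂ) + 2) * ((n : ℂ) + 1 + s₁))⁻¹ ≠ 0 :=
        inv_ne_zero (mul_ne_zero (mul_ne_zero ht (h2 n)) (h1 n))
      have hlin : ∀ a : ℂ, (Polynomial.C a - Polynomial.X : Polynomial ℂ).degree = 1 := by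
        intro a
        rw [← neg_sub, Polynomial.degree_neg, Polynomial.degree_X_sub_C]
      rw [heunPoly, Polynomial.degree_mul, Polynomial.degree_C hc, zero_add]
      set a : ℂ := (1 + t) * ((n : ℂ) + 1) * n + (s₁ * (1 + t) + s₂ * t + s₃) * ((n : ℂ) + 1)
      set b : ℂ := (n : ℂ) * ((n : ℂ) - 1) + (s₁ + s₂ + s₃) * n + r₁ * r₂
      have hA : ((Polynomial.C a - Polynomial.X) *
          heunPoly t s₁ s₂ s₃ r₁ r₂ (n + 1)).degree = ((n + 1 + 1 : ℕ) : WithBot ℕ) := by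
        rw [Polynomial.degree_mul, hlin, ih.2]
        norm_cast
        omega
      have hB : (Polynomial.C b * heunPoly t s₁ s₂ s₃ r₁ r₂ n).degree ≤ (n : WithBot ℕ) := by
        rw [Polynomial.degree_mul, ih.1]
        exact (add_le_add_left Polynomial.degree_C_le _).trans_eq (zero_add _)
      rw [Polynomial.degree_sub_eq_left_of_degree_lt, hA]
      rw [hA]
      refine hB.trans_lt ?_
      norm_cast
      omega
  exact (key i).1

/-- The basis `P_0, P_1, ...` of `ℂ[lam]`. -/
def heunBasis {t s₁ : ℂ} (s₂ s₃ r₁ r₂ : ℂ) (ht : t ≠ 0) (hs₁ : ∀ n : ℕ, s₁ ≠ -(n : ℂ)) :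
    Module.Basis ℕ ℂ (Polynomial ℂ) :=
  Polynomial.Sequence.basis
    { elems' := heunPoly t s₁ s₂ s₃ r₁ r₂
      degree_eq' := degree_heunPoly s₂ s₃ r₁ r₂ ht hs₁ }
    fun i => IsUnit.mk0 _
      (Polynomial.leadingCoeff_ne_zero.mpr (Polynomial.Sequence.ne_zero _ i))

theorem heunBasis_apply {t s₁ : ℂ} (s₂ s₃ r₁ r₂ : ℂ) (ht : t ≠ 0)
    (hs₁ : ∀ n : ℕ, s₁ ≠ -(n : ℂ)) (i : ℕ) :
    heunBasis s₂ s₃ r₁ r₂ ht hs₁ i = heunPoly t s₁ s₂ s₃ r₁ r₂ i :=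
  Polynomial.Sequence.basis_eq_self _ _ i

/-- The structure constants `C_{i,j}^k` of multiplication: `P_i P_j = ∑_k C_{i,j}^k P_k`. -/
def structureConstant {t s₁ : ℂ} (s₂ s₃ r₁ r₂ : ℂ) (ht : t ≠ 0)
    (hs₁ : ∀ n : ℕ, s₁ ≠ -(n : ℂ)) (i j k : ℕ) : ℂ :=
  (heunBasis s₂ s₃ r₁ r₂ ht hs₁).repr
    (heunPoly t s₁ s₂ s₃ r₁ r₂ i * heunPoly t s₁ s₂ s₃ r₁ r₂ j) k

/-- The term `C_{i,j}^k x₁^i x₂^j / y^(k+1)`, `p = (i, j, k)`, of the generating series of the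
structure constants. -/
def kernelTerm {t s₁ : ℂ} (s₂ s₃ r₁ r₂ : ℂ) (ht : t ≠ 0) (hs₁ : ∀ n : ℕ, s₁ ≠ -(n : ℂ))
    (x₁ x₂ y : ℂ) (p : ℕ × ℕ × ℕ) : ℂ :=
  structureConstant s₂ s₃ r₁ r₂ ht hs₁ p.1 p.2.1 p.2.2 * (x₁ ^ p.1 * x₂ ^ p.2.1) /
    y ^ (p.2.2 + 1)

/-- The generating kernel `K(x₁, x₂, y)` of the structure constants. -/
def kernel {t s₁ : ℂ} (s₂ s₃ r₁ r₂ : ℂ) (ht : t ≠ 0) (hs₁ : ∀ n : ℕ, s₁ ≠ -(n : ℂ))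
    (x₁ x₂ y : ℂ) : ℂ :=
  ∑' p : ℕ × ℕ × ℕ, kernelTerm s₂ s₃ r₁ r₂ ht hs₁ x₁ x₂ y p

end Heun

end

noncomputable section

namespace Heun

open Finset

/-! For fixed y the kernel is the solution u of (D_{x₁} - D_{x₂}) u = 0 with u(x, 0) = 1/(y - x).
Indeed, comparing (λ P_i) P_j with P_i (λ P_j) gives a recurrence for the products P_i P_j. The
coefficients g_{ij} of any series annihilated by D_{x₁} - D_{x₂} satisfy the same recurrence, so the
linear functional P_k ↦ g_{k0} sends P_i P_j to g_{ij}; that is, g_{ij} = ∑_k C_{i,j}^k g_{k0}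
(`IsHeunArray.hasSum`).

The equation separates in w = x₁x₂/t and z = (x₁-1)(x₂-1)/((t-1)(w-1)): with d = r₁+r₂-s₁ it has the
solutions u_n = F(-n, d+n, s₂, z) F(r₁+n, r₂+n, s₁, w) (w-1)^n (`separatedCoeff_recurrence`,
`isHeunArray_productArray`). At x₂ = 0 these become the Jacobi polynomials (-1)^n F(-n, d+n, s₂,
(x-1)/(t-1)). It remains to expand 1/(y-x) = ∑_N (x-1)^N/(y-1)^{N+1} in these polynomials. The
expansion coefficients of the powers (`sum_range_jacobi`), summed over N, form the hypergeometric
function of (t-1)/(y-1) (`exists_hasSum_kernelCoeff`).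

All interchanges rest on absolute convergence. The ℓ¹ norm of k ↦ C_{i,j}^k grows at most
geometrically in i + j (`exists_coordNorm_mul_le`), the Jacobi coefficients grow at most
geometrically in n, uniformly in k, and the expansion coefficients decay geometrically at any
prescribed rate once |y| is large. -/

/-! ### Linear growth of `s + k`. -/

/-- No `s + k` vanishes, so a minimum handles the finitely many small k; for large k the term k
dominates s. -/
theorem exists_mul_succ_le_norm_add {s : ℂ} (hs : ∀ n : ℕ, s ≠ -(n : ℂ)) :
    ∃ δ > (0 : ℝ), ∀ k : ℕ, δ * (k + 1) ≤ ‖s + k‖ := by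
  have hne : ∀ k : ℕ, s + k ≠ 0 := fun k h => hs k (eq_neg_of_add_eq_zero_left h)
  obtain ⟨K, hK⟩ := exists_nat_gt (2 * ‖s‖ + 1)
  obtain ⟨δ, hδ, hmin⟩ : ∃ δ > (0 : ℝ), ∀ k < K, δ * (k + 1) ≤ ‖s + k‖ := by
    clear hK
    induction K with
    | zero => exact ⟨1, one_pos, fun k hk => absurd hk (Nat.not_lt_zero k)⟩
    | succ K ih =>
      obtain ⟨δ, hδ, h⟩ := ih
      have hK : 0 < ‖s + K‖ / (K + 1) := div_pos (norm_pos_iff.2 (hne K)) (by positivity)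
      refine ⟨min δ (‖s + K‖ / (K + 1)), lt_min hδ hK, fun k hk => ?_⟩
      rcases Nat.lt_succ_iff_lt_or_eq.1 hk with hk | rfl
      · exact (mul_le_mul_of_nonneg_right (min_le_left _ _) (by positivity)).trans (h k hk)
      · exact (mul_le_mul_of_nonneg_right (min_le_right _ _) (by positivity)).trans
          (div_mul_cancel₀ _ (by positivity)).le
  refine ⟨min δ (1 / 4), lt_min hδ (by norm_num), fun k => ?_⟩
  rcases lt_or_ge k K with hk | hk
  · exact (mul_le_mul_of_nonneg_right (min_le_left _ _) (by positivity)).trans (hmin k hk)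
  · refine (mul_le_mul_of_nonneg_right (min_le_right _ _) (by positivity)).trans ?_
    have hk' : (K : ℝ) ≤ k := by exact_mod_cast hk
    have h1 : ‖(k : ℂ)‖ ≤ ‖s + k‖ + ‖s‖ := by
      simpa using norm_sub_le (s + (k : ℂ)) s
    rw [Complex.norm_natCast] at h1
    have := norm_nonneg s
    linarith

theorem norm_add_natCast_le (s : ℂ) (k : ℕ) : ‖s + k‖ ≤ (‖s‖ + 1) * (k + 1) := by
  have h := norm_add_le s (k : ℂ)
  rw [Complex.norm_natCast] at h
  nlinarith [norm_nonneg s, (Nat.cast_nonneg k : (0 : ℝ) ≤ k)]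

/-! ### The three term recurrence of the Heun polynomials. -/

/-- The coefficient of `P_{i+1}` in the three term recurrence. -/
def leadCoeff (t s₁ : ℂ) (i : ℕ) : ℂ := t * (i + 1) * (i + s₁)

/-- The coefficient of `P_i` in the three term recurrence. -/
def midCoeff (t s₁ s₂ s₃ : ℂ) (i : ℕ) : ℂ :=
  (1 + t) * i * (i - 1) + (s₁ * (1 + t) + s₂ * t + s₃) * i

/-- The coefficient of `P_{i-1}` in the three term recurrence. -/
def lowCoeff (s₁ s₂ s₃ r₁ r₂ : ℂ) : ℕ → ℂ
  | 0 => 0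
  | i + 1 => (i : ℂ) * (i - 1) + (s₁ + s₂ + s₃) * i + r₁ * r₂

theorem leadCoeff_ne_zero {t s₁ : ℂ} (ht : t ≠ 0) (hs₁ : ∀ n : ℕ, s₁ ≠ -(n : ℂ)) (i : ℕ) :
    leadCoeff t s₁ i ≠ 0 := by
  refine mul_ne_zero (mul_ne_zero ht (Nat.cast_add_one_ne_zero i)) fun h => hs₁ i ?_
  linear_combination h

theorem leadCoeff_smul_heunPoly {t s₁ : ℂ} (s₂ s₃ r₁ r₂ : ℂ) (ht : t ≠ 0)
    (hs₁ : ∀ n : ℕ, s₁ ≠ -(n : ℂ)) (i : ℕ) :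
    leadCoeff t s₁ i • heunPoly t s₁ s₂ s₃ r₁ r₂ (i + 1) =
      midCoeff t s₁ s₂ s₃ i • heunPoly t s₁ s₂ s₃ r₁ r₂ i -
        Polynomial.X * heunPoly t s₁ s₂ s₃ r₁ r₂ i -
        lowCoeff s₁ s₂ s₃ r₁ r₂ i • heunPoly t s₁ s₂ s₃ r₁ r₂ (i - 1) := by
  have h0 := leadCoeff_ne_zero ht hs₁ i
  rcases i with _ | n
  · simp only [leadCoeff, CharP.cast_eq_zero, zero_add, mul_one] at h0 ⊢
    simp only [heunPoly, midCoeff, lowCoeff]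
    rw [← Polynomial.C_mul', ← mul_assoc, ← Polynomial.C_mul, mul_inv_cancel₀ h0]
    simp
  · have e : t * ((n : ℂ) + 2) * ((n : ℂ) + 1 + s₁) = leadCoeff t s₁ (n + 1) := by
      simp only [leadCoeff]
      push_cast
      ring
    rw [heunPoly, e, ← Polynomial.C_mul', ← mul_assoc, ← Polynomial.C_mul, mul_inv_cancel₀ h0]
    simp only [midCoeff, lowCoeff, ← Polynomial.C_mul', Nat.add_sub_cancel]
    push_cast
    rw [show (n : ℂ) + 1 - 1 = n by ring]
    simp only [map_one, one_mul]
    ring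

/-- Multiplication by the variable can be moved between the factors of `P_i P_j`. -/
theorem leadCoeff_smul_heunPoly_mul {t s₁ : ℂ} (s₂ s₃ r₁ r₂ : ℂ) (ht : t ≠ 0)
    (hs₁ : ∀ n : ℕ, s₁ ≠ -(n : ℂ)) (i j : ℕ) :
    let P := heunPoly t s₁ s₂ s₃ r₁ r₂
    let b := lowCoeff s₁ s₂ s₃ r₁ r₂
    leadCoeff t s₁ j • (P i * P (j + 1)) =
      leadCoeff t s₁ i • (P (i + 1) * P j) - midCoeff t s₁ s₂ s₃ i • (P i * P j) +
        midCoeff t s₁ s₂ s₃ j • (P i * P j) + b i • (P (i - 1) * P j) -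
        b j • (P i * P (j - 1)) := by
  intro P b
  have hi := leadCoeff_smul_heunPoly s₂ s₃ r₁ r₂ ht hs₁ i
  have hj := leadCoeff_smul_heunPoly s₂ s₃ r₁ r₂ ht hs₁ j
  simp only [← Polynomial.C_mul'] at hi hj ⊢
  linear_combination P i * hj - P j * hi

/-! ### Geometric bounds for the structure constants. -/

section CoordNorm

variable {V : Type*} [AddCommGroup V] [Module ℂ V] (b : Module.Basis ℕ ℂ V)

/-- The `ℓ¹` norm of the coordinates with respect to a basis. -/
def coordNorm (p : V) : ℝ := ∑' k, ‖b.repr p k‖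

theorem summable_norm_repr (p : V) : Summable fun k => ‖b.repr p k‖ :=
  summable_of_ne_finset_zero (s := (b.repr p).support) fun k hk => by
    rw [Finsupp.notMem_support_iff.1 hk, norm_zero]

theorem coordNorm_add_le (p q : V) : coordNorm b (p + q) ≤ coordNorm b p + coordNorm b q := by
  unfold coordNorm
  rw [← (summable_norm_repr b p).tsum_add (summable_norm_repr b q)]
  refine (summable_norm_repr b _).tsum_le_tsum (fun k => ?_)
    ((summable_norm_repr b p).add (summable_norm_repr b q))
  simpa using norm_add_le _ _

theorem coordNorm_smul (a : ℂ) (p : V) : coordNorm b (a • p) = ‖a‖ * coordNorm b p := by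
  simp [coordNorm, tsum_mul_left]

theorem coordNorm_sub_le (p q : V) : coordNorm b (p - q) ≤ coordNorm b p + coordNorm b q := by
  have h : coordNorm b (-q) = coordNorm b q := by
    simpa using coordNorm_smul b (-1) q
  rw [sub_eq_add_neg, ← h]
  exact coordNorm_add_le b p (-q)

theorem coordNorm_self (k : ℕ) : coordNorm b (b k) = 1 := by
  rw [coordNorm, tsum_eq_single k]
  · simp
  · intro l hl
    simp [hl.symm]

theorem coordNorm_nonneg (p : V) : 0 ≤ coordNorm b p := tsum_nonneg fun _ => norm_nonneg _

end CoordNorm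

theorem norm_midCoeff_le (t s₁ s₂ s₃ : ℂ) (i : ℕ) :
    ‖midCoeff t s₁ s₂ s₃ i‖ ≤
      (‖1 + t‖ + ‖s₁ * (1 + t) + s₂ * t + s₃‖) * ((i : ℝ) + 1) ^ 2 := by
  have h1 : ‖(i : ℂ) - 1‖ ≤ i + 1 := (norm_sub_le _ _).trans (by simp)
  unfold midCoeff
  refine (norm_add_le _ _).trans ?_
  rw [norm_mul, norm_mul, norm_mul, Complex.norm_natCast, add_mul]
  have hi : (0 : ℝ) ≤ i := Nat.cast_nonneg i
  have e1 : (i : ℝ) * ‖(i : ℂ) - 1‖ ≤ ((i : ℝ) + 1) ^ 2 := by nlinarith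
  have e2 : (i : ℝ) ≤ ((i : ℝ) + 1) ^ 2 := by nlinarith
  rw [mul_assoc]
  exact add_le_add (mul_le_mul_of_nonneg_left e1 (norm_nonneg _))
    (mul_le_mul_of_nonneg_left e2 (norm_nonneg _))

theorem norm_lowCoeff_le (s₁ s₂ s₃ r₁ r₂ : ℂ) (i : ℕ) :
    ‖lowCoeff s₁ s₂ s₃ r₁ r₂ i‖ ≤
      (1 + ‖s₁ + s₂ + s₃‖ + ‖r₁ * r₂‖) * ((i : ℝ) + 1) ^ 2 := by
  rcases i with _ | i
  · simp only [lowCoeff, norm_zero]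
    positivity
  · have h1 : ‖(i : ℂ) - 1‖ ≤ i + 1 := (norm_sub_le _ _).trans (by simp)
    have hi : (0 : ℝ) ≤ i := Nat.cast_nonneg i
    simp only [lowCoeff]
    refine (norm_add₃_le).trans ?_
    rw [norm_mul, norm_mul _ (i : ℂ), Complex.norm_natCast, add_mul, add_mul]
    push_cast
    have e1 : (i : ℝ) * ‖(i : ℂ) - 1‖ ≤ 1 * ((i : ℝ) + 1 + 1) ^ 2 := by nlinarith
    have e2 : (i : ℝ) ≤ ((i : ℝ) + 1 + 1) ^ 2 := by nlinarith
    have e3 : 1 ≤ ((i : ℝ) + 1 + 1) ^ 2 := by nlinarith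
    exact add_le_add (add_le_add e1 (mul_le_mul_of_nonneg_left e2 (norm_nonneg _)))
      (le_mul_of_one_le_right (norm_nonneg _) e3)

theorem norm_leadCoeff_le (t s₁ : ℂ) (i : ℕ) :
    ‖leadCoeff t s₁ i‖ ≤ (‖t‖ * (‖s₁‖ + 1)) * ((i : ℝ) + 1) ^ 2 := by
  have h := norm_add_natCast_le s₁ i
  have h1 : ‖(i : ℂ) + 1‖ = (i : ℝ) + 1 := by
    exact_mod_cast Complex.norm_natCast (i + 1)
  rw [leadCoeff, norm_mul, norm_mul, add_comm (i : ℂ) s₁, h1]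
  calc _ ≤ ‖t‖ * ((i : ℝ) + 1) * ((‖s₁‖ + 1) * (i + 1)) := by gcongr
    _ = _ := by ring

theorem exists_le_norm_leadCoeff {t s₁ : ℂ} (ht : t ≠ 0) (hs₁ : ∀ n : ℕ, s₁ ≠ -(n : ℂ)) :
    ∃ δ > (0 : ℝ), ∀ i : ℕ, δ * ((i : ℝ) + 1) ^ 2 ≤ ‖leadCoeff t s₁ i‖ := by
  obtain ⟨δ, hδ, h⟩ := exists_mul_succ_le_norm_add hs₁
  refine ⟨‖t‖ * δ, mul_pos (norm_pos_iff.2 ht) hδ, fun i => ?_⟩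
  have h1 : ‖(i : ℂ) + 1‖ = (i : ℝ) + 1 := by
    exact_mod_cast Complex.norm_natCast (i + 1)
  rw [leadCoeff, norm_mul, norm_mul, add_comm (i : ℂ) s₁, h1]
  calc _ = ‖t‖ * ((i : ℝ) + 1) * (δ * (i + 1)) := by ring
    _ ≤ _ := by
      gcongr
      exact h i

/-- Induction on j through `leadCoeff_smul_heunPoly_mul`. Its coefficients are O((i+1)²) or
O((j+1)²), while the leading one is at least of order (j+1)². The unbounded ratio ((i+1)/(j+1))² is
exactly what the squared binomial coefficient absorbs, since (i+1) C(i+j+1, j) = (j+1) C(i+j+1,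
j+1). -/
theorem exists_coordNorm_mul_le {t s₁ : ℂ} (s₂ s₃ r₁ r₂ : ℂ) (ht : t ≠ 0)
    (hs₁ : ∀ n : ℕ, s₁ ≠ -(n : ℂ)) :
    ∃ B ≥ (1 : ℝ), ∀ j i : ℕ,
      coordNorm (heunBasis s₂ s₃ r₁ r₂ ht hs₁)
        (heunPoly t s₁ s₂ s₃ r₁ r₂ i * heunPoly t s₁ s₂ s₃ r₁ r₂ j) ≤
        B ^ j * ((i + j).choose j : ℝ) ^ 2 := by
  obtain ⟨δ, hδ, hlead⟩ := exists_le_norm_leadCoeff ht hs₁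
  obtain ⟨S, hS0, hS1, hS2, hS3⟩ : ∃ S : ℝ, 0 ≤ S ∧
      (∀ i, ‖leadCoeff t s₁ i‖ ≤ S * ((i : ℝ) + 1) ^ 2) ∧
      (∀ i, ‖midCoeff t s₁ s₂ s₃ i‖ ≤ S * ((i : ℝ) + 1) ^ 2) ∧
      (∀ i, ‖lowCoeff s₁ s₂ s₃ r₁ r₂ i‖ ≤ S * ((i : ℝ) + 1) ^ 2) := by
    refine ⟨max (‖t‖ * (‖s₁‖ + 1)) (max (‖1 + t‖ + ‖s₁ * (1 + t) + s₂ * t + s₃‖)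
      (1 + ‖s₁ + s₂ + s₃‖ + ‖r₁ * r₂‖)), le_max_of_le_left (by positivity), fun i => ?_,
      fun i => ?_, fun i => ?_⟩
    · exact (norm_leadCoeff_le t s₁ i).trans (by gcongr; exact le_max_left _ _)
    · refine (norm_midCoeff_le t s₁ s₂ s₃ i).trans ?_
      gcongr
      exact le_max_of_le_right (le_max_left _ _)
    · refine (norm_lowCoeff_le s₁ s₂ s₃ r₁ r₂ i).trans ?_
      gcongr
      exact le_max_of_le_right (le_max_right _ _)
  set P := heunPoly t s₁ s₂ s₃ r₁ r₂ with hP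
  set N := coordNorm (heunBasis s₂ s₃ r₁ r₂ ht hs₁) with hN
  -- The recurrence has five terms on the right, each bounded through S; δ is the lower constant of
  -- the leading coefficient.
  set B := max 1 (5 * S / δ) with hB
  have hB1 : 1 ≤ B := le_max_left _ _
  have hB5 : 5 * S ≤ B * δ := by
    rw [← div_le_iff₀ hδ]
    exact le_max_right _ _
  refine ⟨B, hB1, fun j => ?_⟩
  induction j using Nat.strong_induction_on with
  | _ j ih =>
  rcases j with _ | j
  · intro i
    have : P i * P 0 = heunBasis s₂ s₃ r₁ r₂ ht hs₁ i := by
      rw [heunBasis_apply]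
      simp [hP, heunPoly]
    rw [this, hN, coordNorm_self]
    simp
  intro i
  have key := leadCoeff_smul_heunPoly_mul s₂ s₃ r₁ r₂ ht hs₁ i j
  simp only [← hP] at key
  set w : ℝ := (((i + (j + 1)).choose (j + 1) : ℕ) : ℝ) with hw
  have hj1 : (0 : ℝ) < (j : ℝ) + 1 := by positivity
  -- all the binomial coefficients that occur, against the new one
  have c1 : ((i : ℝ) + 1) * ((i + 1 + j).choose j : ℕ) = (j + 1) * w := by
    have := Nat.choose_succ_right_eq (i + 1 + j) j
    rw [show i + 1 + j - j = i + 1 by omega] at this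
    rw [hw, show i + (j + 1) = i + 1 + j by ring]
    exact_mod_cast (by linarith : (i + 1) * (i + 1 + j).choose j =
      (j + 1) * (i + 1 + j).choose (j + 1))
  have c2 : ((i : ℝ) + j + 1) * ((i + j).choose j : ℕ) = (j + 1) * w := by
    have := Nat.add_one_mul_choose_eq (i + j) j
    rw [hw, show i + (j + 1) = i + j + 1 by ring]
    exact_mod_cast (by linarith : (i + j + 1) * (i + j).choose j =
      (j + 1) * (i + j + 1).choose (j + 1))
  have hi0 : (0 : ℝ) ≤ i := Nat.cast_nonneg i
  have hj0 : (0 : ℝ) ≤ j := Nat.cast_nonneg j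
  have hBj : (0 : ℝ) ≤ B ^ j := by positivity
  -- Here k is i + 1 or j + 1, z a binomial coefficient, and x the norm of one of the five products.
  have hmain : ∀ (x k z : ℝ), 0 ≤ k → 0 ≤ z → x ≤ B ^ j * z ^ 2 → k * z ≤ (j + 1) * w →
      S * k ^ 2 * x ≤ S * B ^ j * ((j + 1) * w) ^ 2 := by
    intro x k z hk hz hx hkz
    calc S * k ^ 2 * x ≤ S * k ^ 2 * (B ^ j * z ^ 2) := by gcongr
      _ = S * B ^ j * (k * z) ^ 2 := by ring
      _ ≤ _ := by gcongr
  set z : ℝ := (((i + j).choose j : ℕ) : ℝ) with hz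
  have hz0 : 0 ≤ z := Nat.cast_nonneg _
  have hi2 : ((i : ℝ) + 1) * z ≤ (j + 1) * w := by rw [← c2]; nlinarith
  have hj2 : ((j : ℝ) + 1) * z ≤ (j + 1) * w := by rw [← c2]; nlinarith
  have e1 := hmain _ _ _ (by positivity) (Nat.cast_nonneg _) (ih j (by omega) (i + 1)) c1.le
  have e2 := hmain _ _ _ (by positivity) hz0 (ih j (by omega) i) hi2
  have e3 := hmain _ _ _ (by positivity) hz0 (ih j (by omega) i) hj2
  have e4 : N (P (i - 1) * P j) ≤ B ^ j * z ^ 2 := by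
    refine (ih j (by omega) (i - 1)).trans ?_
    gcongr
    exact Nat.cast_le.2 (Nat.choose_le_choose j (show i - 1 + j ≤ i + j by omega))
  have e4 := hmain _ _ _ (by positivity) hz0 e4 hi2
  have e5 : N (P i * P (j - 1)) ≤ B ^ j * z ^ 2 := by
    refine (ih (j - 1) (by omega) i).trans ?_
    have h1 : (i + (j - 1)).choose (j - 1) ≤ (i + j).choose j := by
      rw [← Nat.choose_symm_add, ← Nat.choose_symm_add]
      exact Nat.choose_le_choose i (show i + (j - 1) ≤ i + j by omega)
    have h2 : (((i + (j - 1)).choose (j - 1) : ℕ) : ℝ) ≤ z := by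
      rw [hz]
      exact_mod_cast h1
    exact mul_le_mul (pow_le_pow_right₀ hB1 (by omega))
      (pow_le_pow_left₀ (Nat.cast_nonneg _) h2 2) (by positivity) hBj
  have e5 := hmain _ _ _ (by positivity) hz0 e5 hj2
  have hN0 : ∀ p, 0 ≤ N p := coordNorm_nonneg _
  have tot : ‖leadCoeff t s₁ j‖ * N (P i * P (j + 1)) ≤ 5 * (S * B ^ j * ((j + 1) * w) ^ 2) := by
    rw [hN, ← coordNorm_smul, ← hN, key]
    refine (coordNorm_sub_le _ _ _).trans ?_
    refine (add_le_add_left (coordNorm_add_le _ _ _) _).trans ?_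
    refine (add_le_add_left (add_le_add_left (coordNorm_add_le _ _ _) _) _).trans ?_
    refine (add_le_add_left (add_le_add_left (add_le_add_left
      (coordNorm_sub_le _ _ _) _) _) _).trans ?_
    simp only [coordNorm_smul, ← hN]
    have f1 := mul_le_mul_of_nonneg_right (hS1 i) (hN0 (P (i + 1) * P j))
    have f2 := mul_le_mul_of_nonneg_right (hS2 i) (hN0 (P i * P j))
    have f3 := mul_le_mul_of_nonneg_right (hS2 j) (hN0 (P i * P j))
    have f4 := mul_le_mul_of_nonneg_right (hS3 i) (hN0 (P (i - 1) * P j))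
    have f5 := mul_le_mul_of_nonneg_right (hS3 j) (hN0 (P i * P (j - 1)))
    linarith
  have fin1 : δ * ((j : ℝ) + 1) ^ 2 * N (P i * P (j + 1)) ≤
      δ * ((j : ℝ) + 1) ^ 2 * (B ^ (j + 1) * w ^ 2) := by
    calc _ ≤ ‖leadCoeff t s₁ j‖ * N (P i * P (j + 1)) :=
          mul_le_mul_of_nonneg_right (hlead j) (hN0 _)
      _ ≤ 5 * (S * B ^ j * ((j + 1) * w) ^ 2) := tot
      _ = (5 * S) * (B ^ j * ((j + 1) * w) ^ 2) := by ring
      _ ≤ (B * δ) * (B ^ j * ((j + 1) * w) ^ 2) := by gcongr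
      _ = _ := by ring
  exact le_of_mul_le_mul_left fin1 (by positivity)


theorem summable_pow_mul_pow : Summable fun p : ℕ × ℕ => (1 / 2 : ℝ) ^ p.1 * (1 / 2) ^ p.2 :=
  summable_geometric_two.mul_of_nonneg summable_geometric_two
    (fun _ => pow_nonneg (by norm_num) _) fun _ => pow_nonneg (by norm_num) _

theorem exists_summable_structureConstant {t s₁ : ℂ} (s₂ s₃ r₁ r₂ : ℂ) (ht : t ≠ 0)
    (hs₁ : ∀ n : ℕ, s₁ ≠ -(n : ℂ)) :
    ∃ ρ > (0 : ℝ), ∀ a b : ℝ, 0 ≤ a → 0 ≤ b → a ≤ ρ → b ≤ ρ →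
      Summable fun p : ℕ × ℕ × ℕ =>
        ‖structureConstant s₂ s₃ r₁ r₂ ht hs₁ p.1 p.2.1 p.2.2‖ * (a ^ p.1 * b ^ p.2.1) := by
  obtain ⟨B, hB, hN⟩ := exists_coordNorm_mul_le s₂ s₃ r₁ r₂ ht hs₁
  have hB0 : 0 < B := one_pos.trans_le hB
  -- The squared binomial is at most 4^(i+j), so the terms are bounded by (4a)^i (4Bb)^j, and both
  -- ratios are at most 1/2 for this radius.
  refine ⟨1 / (8 * B), by positivity, fun a b ha hb haρ hbρ => ?_⟩
  have ha' : 4 * a ≤ 1 / 2 := by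
    rw [le_div_iff₀ (by positivity)] at haρ
    nlinarith
  have hb' : 4 * (B * b) ≤ 1 / 2 := by
    rw [le_div_iff₀ (by positivity)] at hbρ
    linarith
  rw [← (Equiv.prodAssoc ℕ ℕ ℕ).summable_iff]
  have hinner : ∀ q : ℕ × ℕ, Summable fun k =>
      ‖structureConstant s₂ s₃ r₁ r₂ ht hs₁ q.1 q.2 k‖ * (a ^ q.1 * b ^ q.2) := fun q =>
    (summable_norm_repr _ _).mul_right _
  refine (summable_prod_of_nonneg fun p => mul_nonneg (norm_nonneg _)
    (mul_nonneg (pow_nonneg ha _) (pow_nonneg hb _))).2 ⟨hinner, ?_⟩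
  refine summable_pow_mul_pow.of_nonneg_of_le (fun q => tsum_nonneg fun k => by positivity) fun q => ?_
  have hsum : ∑' k, ‖structureConstant s₂ s₃ r₁ r₂ ht hs₁ q.1 q.2 k‖ ≤
      B ^ q.2 * ((q.1 + q.2).choose q.2 : ℝ) ^ 2 := hN q.2 q.1
  have hch : ((q.1 + q.2).choose q.2 : ℝ) ≤ 2 ^ (q.1 + q.2) := by
    exact_mod_cast Nat.choose_le_two_pow (q.1 + q.2) q.2
  calc ∑' k, ‖structureConstant s₂ s₃ r₁ r₂ ht hs₁ q.1 q.2 k‖ * (a ^ q.1 * b ^ q.2)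
      = (∑' k, ‖structureConstant s₂ s₃ r₁ r₂ ht hs₁ q.1 q.2 k‖) * (a ^ q.1 * b ^ q.2) :=
        tsum_mul_right
    _ ≤ (B ^ q.2 * ((2 : ℝ) ^ (q.1 + q.2)) ^ 2) * (a ^ q.1 * b ^ q.2) := by
        refine mul_le_mul_of_nonneg_right (hsum.trans ?_) (by positivity)
        gcongr
    _ = (4 * a) ^ q.1 * (4 * (B * b)) ^ q.2 := by
        have h4 : ∀ n : ℕ, (4 : ℝ) ^ n = 2 ^ (n * 2) := fun n => by
          rw [mul_comm, pow_mul]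
          norm_num
        rw [mul_pow 4, mul_pow 4, h4, h4]
        ring
    _ ≤ _ := by gcongr

/-! ### Arrays annihilated by the difference of two Heun operators. -/

/-- An array annihilated by the difference of the two copies of the Heun operator (without the
accessory parameter) acting on the rows and on the columns. -/
def IsHeunArray (t s₁ s₂ s₃ r₁ r₂ : ℂ) (g : ℕ → ℕ → ℂ) : Prop :=
  ∀ i j : ℕ,
    leadCoeff t s₁ i * g (i + 1) j - midCoeff t s₁ s₂ s₃ i * g i j +
        lowCoeff s₁ s₂ s₃ r₁ r₂ i * g (i - 1) j =
      leadCoeff t s₁ j * g i (j + 1) - midCoeff t s₁ s₂ s₃ j * g i j +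
        lowCoeff s₁ s₂ s₃ r₁ r₂ j * g i (j - 1)

/-- A Heun array is determined by its first column through the structure constants. -/
theorem IsHeunArray.hasSum {t s₁ s₂ s₃ r₁ r₂ : ℂ} {g : ℕ → ℕ → ℂ}
    (hg : IsHeunArray t s₁ s₂ s₃ r₁ r₂ g) (ht : t ≠ 0) (hs₁ : ∀ n : ℕ, s₁ ≠ -(n : ℂ))
    (i j : ℕ) :
    HasSum (fun k => structureConstant s₂ s₃ r₁ r₂ ht hs₁ i j k * g k 0) (g i j) := by
  set b := heunBasis s₂ s₃ r₁ r₂ ht hs₁ with hb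
  set P := heunPoly t s₁ s₂ s₃ r₁ r₂ with hP
  -- The functional P_k ↦ g k 0 is evaluated on P_i P_j column by column: the values and the array
  -- obey the same recurrence in j, whose leading coefficient never vanishes.
  have hfun : ∀ j i : ℕ, b.constr ℂ (fun k => g k 0) (P i * P j) = g i j := by
    intro j
    induction j using Nat.strong_induction_on with
    | _ j ih =>
    rcases j with _ | j
    · intro i
      have : P i * P 0 = b i := by
        rw [hb, heunBasis_apply]
        simp [hP, heunPoly]
      rw [this, Module.Basis.constr_basis]
    intro i
    have key := congrArg (b.constr ℂ (fun k => g k 0))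
      (leadCoeff_smul_heunPoly_mul s₂ s₃ r₁ r₂ ht hs₁ i j)
    simp only [← hP, map_add, map_sub, map_smul, smul_eq_mul] at key
    rw [ih j (by omega), ih j (by omega), ih j (by omega), ih (j - 1) (by omega)] at key
    refine mul_left_cancel₀ (leadCoeff_ne_zero ht hs₁ j) ?_
    linear_combination key + hg i j
  have h := hfun j i
  rw [Module.Basis.constr_apply] at h
  rw [← h, Finsupp.sum]
  refine hasSum_sum_of_ne_finset_zero fun k hk => ?_
  have h0 : structureConstant s₂ s₃ r₁ r₂ ht hs₁ i j k = 0 := Finsupp.notMem_support_iff.1 hk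
  rw [h0, zero_mul]

/-! ### Expansion of (x - 1)^m x^l. -/

/-- The coefficient of `x ^ i` in `(x - 1) ^ m * x ^ l`. -/
def shiftedBinomial (m l i : ℕ) : ℂ :=
  PowerSeries.coeff i ((PowerSeries.X - 1) ^ m * PowerSeries.X ^ l : PowerSeries ℂ)

theorem coeff_X_sub_one_pow (m i : ℕ) :
    PowerSeries.coeff i ((PowerSeries.X - 1) ^ m : PowerSeries ℂ) =
      (-1) ^ (m + i) * (m.choose i : ℂ) := by
  have h : ((PowerSeries.X - 1) ^ m : PowerSeries ℂ) =
      (((Polynomial.X - Polynomial.C 1) ^ m : Polynomial ℂ) : PowerSeries ℂ) := by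
    simp
  rw [h, Polynomial.coeff_coe, sub_eq_add_neg, ← Polynomial.C_neg, Polynomial.coeff_X_add_C_pow]
  rcases le_or_gt i m with hi | hi
  · rw [show m + i = m - i + 2 * i by omega, pow_add, pow_mul]
    simp
  · simp [Nat.choose_eq_zero_of_lt hi]

theorem shiftedBinomial_eq (m l i : ℕ) :
    shiftedBinomial m l i =
      if l ≤ i then (-1) ^ (m + (i - l)) * (m.choose (i - l) : ℂ) else 0 := by
  rw [shiftedBinomial, PowerSeries.coeff_mul_X_pow', coeff_X_sub_one_pow]

theorem shiftedBinomial_eq_zero {m l i : ℕ} (h : i < l) : shiftedBinomial m l i = 0 := by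
  rw [shiftedBinomial_eq, if_neg (by omega)]

theorem shiftedBinomial_add (m l i : ℕ) :
    shiftedBinomial m l (i + l) = (-1) ^ (m + i) * (m.choose i : ℂ) := by
  rw [shiftedBinomial_eq, if_pos (by omega), Nat.add_sub_cancel]

theorem hasSum_shiftedBinomial (m l : ℕ) (x : ℂ) :
    HasSum (fun i => shiftedBinomial m l i * x ^ i) ((x - 1) ^ m * x ^ l) := by
  have hinj : Function.Injective fun i : ℕ => i + l := add_left_injective l
  rw [← hinj.hasSum_iff]
  · have h : HasSum (fun i : ℕ => (-1) ^ (m + i) * (m.choose i : ℂ) * x ^ i) ((x - 1) ^ m) := by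
      rw [sub_eq_add_neg, add_pow]
      have : ∑ i ∈ range (m + 1), x ^ i * (-1) ^ (m - i) * (m.choose i : ℂ) =
          ∑ i ∈ range (m + 1), (-1) ^ (m + i) * (m.choose i : ℂ) * x ^ i := by
        refine sum_congr rfl fun i hi => ?_
        have hi' : i ≤ m := Nat.lt_succ_iff.1 (mem_range.1 hi)
        rw [show m + i = m - i + 2 * i by omega, pow_add _ _ (2 * i), pow_mul]
        ring
      rw [this]
      refine hasSum_sum_of_ne_finset_zero fun i hi => ?_
      rw [Nat.choose_eq_zero_of_lt (by simpa using hi)]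
      simp
    convert! h.mul_right (x ^ l) using 1
    funext i
    simp only [Function.comp_apply, shiftedBinomial_add]
    ring
  · intro i hi
    rw [shiftedBinomial_eq_zero, zero_mul]
    by_contra h
    exact hi ⟨i - l, by simp only; omega⟩

theorem hasSum_norm_shiftedBinomial (m l : ℕ) (x : ℝ) :
    HasSum (fun i => ‖shiftedBinomial m l i‖ * x ^ i) ((x + 1) ^ m * x ^ l) := by
  have hinj : Function.Injective fun i : ℕ => i + l := add_left_injective l
  rw [← hinj.hasSum_iff]
  · have h : HasSum (fun i : ℕ => (m.choose i : ℝ) * x ^ i) ((x + 1) ^ m) := by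
      have : (x + 1) ^ m = ∑ i ∈ range (m + 1), (m.choose i : ℝ) * x ^ i := by
        rw [add_pow]
        exact sum_congr rfl fun i _ => by ring
      rw [this]
      refine hasSum_sum_of_ne_finset_zero fun i hi => ?_
      rw [Nat.choose_eq_zero_of_lt (by simpa using hi)]
      simp
    convert! h.mul_right (x ^ l) using 1
    funext i
    simp only [Function.comp_apply, shiftedBinomial_add, norm_mul, norm_pow, norm_neg, norm_one,
      one_pow, one_mul, Complex.norm_natCast]
    ring
  · intro i hi
    rw [shiftedBinomial_eq_zero, norm_zero, zero_mul]
    by_contra h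
    exact hi ⟨i - l, by simp only; omega⟩

theorem norm_shiftedBinomial_zero_le (m i : ℕ) : ‖shiftedBinomial m 0 i‖ ≤ 2 ^ m := by
  have h := shiftedBinomial_add m 0 i
  rw [add_zero] at h
  rw [h]
  simp only [norm_mul, norm_pow, norm_neg, norm_one, one_pow, one_mul, Complex.norm_natCast]
  exact_mod_cast Nat.choose_le_two_pow m i


/-! ### The Heun operator on (x - 1)^m x^l, and the difference operator in two variables. -/

theorem coeff_heunOperator_zero (t s₁ s₂ s₃ r₁ r₂ : ℂ) (f : PowerSeries ℂ) (i : ℕ) :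
    PowerSeries.coeff i (heunOperator t s₁ s₂ s₃ r₁ r₂ 0 f) =
      leadCoeff t s₁ i * PowerSeries.coeff (i + 1) f -
        midCoeff t s₁ s₂ s₃ i * PowerSeries.coeff i f +
        lowCoeff s₁ s₂ s₃ r₁ r₂ i * PowerSeries.coeff (i - 1) f := by
  rcases i with _ | n
  · rw [coeff_zero_heunOperator]
    simp [leadCoeff, midCoeff, lowCoeff]
  · rw [coeff_succ_heunOperator]
    simp only [leadCoeff, midCoeff, lowCoeff, Nat.add_sub_cancel]
    push_cast
    ring

section Bivariate

open PowerSeries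

/-- The product `q(x₁) r(x₂)` as a power series in `x₂` over power series in `x₁`. -/
def tensor (q r : PowerSeries ℂ) : PowerSeries (PowerSeries ℂ) := C q * map C r

theorem coeff_tensor (q r : PowerSeries ℂ) (i j : ℕ) :
    coeff i (coeff j (tensor q r)) = coeff i q * coeff j r := by
  rw [tensor, coeff_C_mul, coeff_map, coeff_mul_C]

/-- The power series `(x - 1) ^ m * x ^ l`. -/
def binomialSeries (m l : ℕ) : PowerSeries ℂ := (X - 1) ^ m * X ^ l

theorem coeff_binomialSeries (m l i : ℕ) :
    coeff i (binomialSeries m l) = shiftedBinomial m l i := rfl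

/-- This is the logarithmic derivative m/(x-1) + l/x with denominators cleared, which avoids the
exponents m - 1 and l - 1. -/
theorem X_mul_derivative_binomialSeries (m l : ℕ) :
    X * (X - 1) * derivative ℂ (binomialSeries m l) =
      (C (m : ℂ) * X + C (l : ℂ) * (X - 1)) * binomialSeries m l := by
  have hm : (X - 1) * derivative ℂ ((X - 1 : PowerSeries ℂ) ^ m) = C (m : ℂ) * (X - 1) ^ m := by
    rcases m with _ | m
    · simp
    · rw [PowerSeries.derivative_pow, map_sub, derivative_X, derivative_one]
      simp only [Nat.add_sub_cancel, map_natCast]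
      ring
  have hl : X * derivative ℂ ((X : PowerSeries ℂ) ^ l) = C (l : ℂ) * X ^ l := by
    rcases l with _ | l
    · simp
    · rw [PowerSeries.derivative_pow, derivative_X]
      simp only [Nat.add_sub_cancel, map_natCast]
      ring
  rw [binomialSeries, Derivation.leibniz]
  simp only [smul_eq_mul]
  linear_combination (X - 1) * (X - 1) ^ m * hl + X * X ^ l * hm

theorem X_mul_derivative_derivative_binomialSeries (m l : ℕ) :
    (X * (X - 1)) ^ 2 * derivative ℂ (derivative ℂ (binomialSeries m l)) =
      (C (m : ℂ) * (C (m : ℂ) - 1) * X ^ 2 + 2 * C (m : ℂ) * C (l : ℂ) * X * (X - 1) +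
        C (l : ℂ) * (C (l : ℂ) - 1) * (X - 1) ^ 2) * binomialSeries m l := by
  have h1 := X_mul_derivative_binomialSeries m l
  have h2 := congrArg (derivative ℂ) h1
  simp only [Derivation.leibniz, map_add, map_sub, derivative_X, derivative_one, derivative_C,
    smul_eq_mul] at h2
  linear_combination X * (X - 1) * h2 +
    (C (m : ℂ) * X + C (l : ℂ) * (X - 1) - (2 * X - 1)) * h1

theorem X_mul_heunOperator_binomialSeries (t s₁ s₂ s₃ r₁ r₂ : ℂ) (m l : ℕ) :
    X * (X - 1) * heunOperator t s₁ s₂ s₃ r₁ r₂ 0 (binomialSeries m l) =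
      ((X - C t) * (C (m : ℂ) * (C (m : ℂ) - 1) * X ^ 2 +
          2 * C (m : ℂ) * C (l : ℂ) * X * (X - 1) + C (l : ℂ) * (C (l : ℂ) - 1) * (X - 1) ^ 2) +
        (C s₁ * (X - 1) * (X - C t) + C s₂ * X * (X - C t) + C s₃ * X * (X - 1)) *
          (C (m : ℂ) * X + C (l : ℂ) * (X - 1)) + X * (X - 1) * (C (r₁ * r₂) * X)) *
        binomialSeries m l := by
  rw [heunOperator, map_zero]
  linear_combination (X - C t) * X_mul_derivative_derivative_binomialSeries m l +
    (C s₁ * (X - 1) * (X - C t) + C s₂ * X * (X - C t) + C s₃ * X * (X - 1)) *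
      X_mul_derivative_binomialSeries m l

/-- The difference of the two Heun operators applied to `((x₁ - 1)(x₂ - 1)) ^ m (x₁ x₂) ^ l`. -/
theorem tensor_heunOperator_sub (t s₁ s₂ s₃ r₁ r₂ : ℂ) (m l : ℕ) :
    tensor (heunOperator t s₁ s₂ s₃ r₁ r₂ 0 (binomialSeries m l)) (binomialSeries m l) -
        tensor (binomialSeries m l) (heunOperator t s₁ s₂ s₃ r₁ r₂ 0 (binomialSeries m l)) =
      (C X - X) *
        (C (C (((m : ℂ) + l) * ((m : ℂ) + l - 1 + (s₁ + s₂ + s₃)) + r₁ * r₂)) *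
            tensor (binomialSeries m l) (binomialSeries m l) +
          C (C ((t - 1) * (m * (m - 1 + s₂)))) *
            tensor (binomialSeries (m - 1) l) (binomialSeries (m - 1) l) -
          C (C (t * (l * (l - 1 + s₁)))) *
            tensor (binomialSeries m (l - 1)) (binomialSeries m (l - 1))) := by
  -- The factor m makes the truncated exponent m - 1 harmless at m = 0; likewise for l below.
  have hm : C (C (m : ℂ)) * ((C X - 1) * (X - 1) *
      tensor (binomialSeries (m - 1) l) (binomialSeries (m - 1) l)) =
      C (C (m : ℂ)) * tensor (binomialSeries m l) (binomialSeries m l) := by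
    rcases m with _ | m
    · simp
    · simp only [tensor, binomialSeries, Nat.add_sub_cancel, map_mul, map_pow, map_sub, map_one,
        map_X]
      ring
  have hl : C (C (l : ℂ)) * (C X * X *
      tensor (binomialSeries m (l - 1)) (binomialSeries m (l - 1))) =
      C (C (l : ℂ)) * tensor (binomialSeries m l) (binomialSeries m l) := by
    rcases l with _ | l
    · simp
    · simp only [tensor, binomialSeries, Nat.add_sub_cancel, map_mul, map_pow, map_X]
      ring
  have h := X_mul_heunOperator_binomialSeries t s₁ s₂ s₃ r₁ r₂ m l
  have h1 := congrArg (C (R := PowerSeries ℂ)) h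
  have h2 := congrArg (map (C (R := ℂ))) h
  simp only [map_add, map_sub, map_mul, map_pow, map_one, map_X, map_ofNat, PowerSeries.map_C]
    at h1 h2
  have hX : (X : PowerSeries (PowerSeries ℂ)) ≠ 0 := X_ne_zero
  have hX1 : (X - 1 : PowerSeries (PowerSeries ℂ)) ≠ 0 := fun h => by
    simpa using congrArg (constantCoeff (R := PowerSeries ℂ)) h
  have hx1 : (X - 1 : PowerSeries ℂ) ≠ 0 := fun h => by
    simpa using congrArg (constantCoeff (R := ℂ)) h
  have hCX : (C X : PowerSeries (PowerSeries ℂ)) ≠ 0 := fun h =>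
    X_ne_zero (R := ℂ) (C_injective (h.trans (map_zero _).symm))
  have hCX1 : (C X - 1 : PowerSeries (PowerSeries ℂ)) ≠ 0 := fun h =>
    hx1 (C_injective (R := PowerSeries ℂ) (by rw [map_sub, map_one, h, map_zero]))
  -- The identity is checked after multiplication by x₁(x₁-1)x₂(x₂-1), which is cancellable in a
  -- domain.
  refine mul_left_cancel₀ (mul_ne_zero (mul_ne_zero hCX hCX1) (mul_ne_zero hX hX1)) ?_
  simp only [map_add, map_sub, map_mul, map_one]
  simp only [tensor] at hm hl ⊢
  linear_combination X * (X - 1) * map C (binomialSeries m l) * h1 -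
    C X * (C X - 1) * C (binomialSeries m l) * h2 -
    (C X - X) * C X * X * (C (C t) - 1) * (C (C (m : ℂ)) - 1 + C (C s₂)) * hm +
    (C X - X) * (C X - 1) * (X - 1) * C (C t) * (C (C (l : ℂ)) - 1 + C (C s₁)) * hl

theorem coeff_sub_mul_tensor (q : PowerSeries ℂ) (i j : ℕ) :
    coeff i (coeff j ((C X - X) * tensor q q)) =
      coeff i (X * q) * coeff j q - coeff i q * coeff j (X * q) := by
  have : (C X - X) * tensor q q = tensor (X * q) q - tensor q (X * q) := by
    simp only [tensor, map_mul, map_X]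
    ring
  rw [this, map_sub, map_sub, coeff_tensor, coeff_tensor]

end Bivariate

/-! ### Series in (x₁-1)(x₂-1) and x₁x₂ as Heun arrays. -/

/-- The coefficient array of `∑ g_{m,l} ((x₁ - 1)(x₂ - 1)) ^ m (x₁ x₂) ^ l`, `m ≤ n`. -/
def productArray (n : ℕ) (g : ℕ → ℕ → ℂ) (i j : ℕ) : ℂ :=
  ∑ m ∈ range (n + 1), ∑ l ∈ range (j + 1),
    g m l * (shiftedBinomial m l i * shiftedBinomial m l j)

/-- The factor x₂^l kills the terms with l > j, so neighbouring columns can share one truncation. -/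
theorem productArray_eq {n : ℕ} {g : ℕ → ℕ → ℂ} {i j N : ℕ} (h : j < N) :
    productArray n g i j = ∑ m ∈ range (n + 1), ∑ l ∈ range N,
      g m l * (shiftedBinomial m l i * shiftedBinomial m l j) := by
  refine sum_congr rfl fun m _ => sum_subset (range_subset_range.2 h) fun l _ hl => ?_
  rw [shiftedBinomial_eq_zero (i := j) (by simpa using hl), mul_zero, mul_zero]

/-- By `tensor_heunOperator_sub` the difference operator produces x₁ - x₂ times a series of the same
kind. Shifting m and l collects its coefficients into `hrec`. -/
theorem isHeunArray_productArray {t s₁ s₂ s₃ r₁ r₂ : ℂ} (hr : r₁ + r₂ = s₁ + s₂ + s₃ - 1)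
    {n : ℕ} {g : ℕ → ℕ → ℂ} (hn : ∀ l, g (n + 1) l = 0)
    (hrec : ∀ m l : ℕ, t * (((l : ℂ) + 1) * (l + s₁)) * g m (l + 1) =
      (m + l + r₁) * (m + l + r₂) * g m l + (t - 1) * (((m : ℂ) + 1) * (m + s₂)) * g (m + 1) l) :
    IsHeunArray t s₁ s₂ s₃ r₁ r₂ (productArray n g) := by
  intro i j
  set V : ℕ → ℕ → ℂ := fun m l => PowerSeries.coeff i (PowerSeries.coeff j
    ((PowerSeries.C PowerSeries.X - PowerSeries.X) *
      tensor (binomialSeries m l) (binomialSeries m l))) with hV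
  -- The factor (x₁x₂)^(j+1) leaves no term x₂^j; this removes the boundary term of the shift in l,
  -- as `hn` does for m.
  have hV0 : ∀ m, V m (j + 1) = 0 := by
    intro m
    simp only [hV, coeff_sub_mul_tensor, coeff_binomialSeries]
    rw [shiftedBinomial_eq_zero (i := j) (by omega)]
    rcases j with _ | j
    · simp
    · rw [PowerSeries.coeff_succ_X_mul, coeff_binomialSeries, shiftedBinomial_eq_zero (i := j) (by omega)]
      simp
  set N := j + 2 with hN
  rw [productArray_eq (N := N) (i := i + 1) (j := j) (by omega),
    productArray_eq (N := N) (i := i) (j := j) (by omega),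
    productArray_eq (N := N) (i := i - 1) (j := j) (by omega),
    productArray_eq (N := N) (i := i) (j := j + 1) (by omega),
    productArray_eq (N := N) (i := i) (j := j - 1) (by omega), ← sub_eq_zero]
  have hterm : ∀ m l : ℕ,
      (leadCoeff t s₁ i * shiftedBinomial m l (i + 1) -
          midCoeff t s₁ s₂ s₃ i * shiftedBinomial m l i +
          lowCoeff s₁ s₂ s₃ r₁ r₂ i * shiftedBinomial m l (i - 1)) * shiftedBinomial m l j -
        shiftedBinomial m l i * (leadCoeff t s₁ j * shiftedBinomial m l (j + 1) -
          midCoeff t s₁ s₂ s₃ j * shiftedBinomial m l j +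
          lowCoeff s₁ s₂ s₃ r₁ r₂ j * shiftedBinomial m l (j - 1)) =
      (m + l + r₁) * (m + l + r₂) * V m l +
        (t - 1) * (m * (m - 1 + s₂)) * V (m - 1) l - t * (l * (l - 1 + s₁)) * V m (l - 1) := by
    intro m l
    have h := congrArg (fun f => PowerSeries.coeff i (PowerSeries.coeff j f))
      (tensor_heunOperator_sub t s₁ s₂ s₃ r₁ r₂ m l)
    simp only [map_sub, coeff_tensor, coeff_heunOperator_zero, coeff_binomialSeries] at h
    have hlin : ∀ (a b c : ℂ) (W T₁ T₂ T₃ : PowerSeries (PowerSeries ℂ)),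
        PowerSeries.coeff i (PowerSeries.coeff j (W *
          (PowerSeries.C (PowerSeries.C a) * T₁ + PowerSeries.C (PowerSeries.C b) * T₂ -
            PowerSeries.C (PowerSeries.C c) * T₃))) =
        a * PowerSeries.coeff i (PowerSeries.coeff j (W * T₁)) +
          b * PowerSeries.coeff i (PowerSeries.coeff j (W * T₂)) -
          c * PowerSeries.coeff i (PowerSeries.coeff j (W * T₃)) := by
      intro a b c W T₁ T₂ T₃
      rw [mul_sub, mul_add, mul_left_comm W, mul_left_comm W, mul_left_comm W]
      simp only [map_sub, map_add, PowerSeries.coeff_C_mul]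
    rw [h, hlin]
    simp only [hV]
    -- The relation between the exponents factors (m+l)(m+l-1+s₁+s₂+s₃) + r₁r₂ as (m+l+r₁)(m+l+r₂).
    linear_combination (-((m : ℂ) + l)) * hr * V m l
  have hm : ∀ l, ∑ m ∈ range (n + 1), g m l * ((t - 1) * (m * (m - 1 + s₂)) * V (m - 1) l) =
      ∑ m ∈ range (n + 1), (t - 1) * (((m : ℂ) + 1) * (m + s₂)) * g (m + 1) l * V m l := by
    intro l
    rw [sum_range_succ', sum_range_succ _ n, hn]
    simp only [CharP.cast_eq_zero, zero_mul, mul_zero, add_zero, Nat.add_sub_cancel]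
    refine sum_congr rfl fun m _ => ?_
    push_cast
    ring
  have hl : ∀ m, ∑ l ∈ range N, g m l * (t * (l * (l - 1 + s₁)) * V m (l - 1)) =
      ∑ l ∈ range N, t * (((l : ℂ) + 1) * (l + s₁)) * g m (l + 1) * V m l := by
    intro m
    rw [hN, sum_range_succ', sum_range_succ _ (j + 1), hV0]
    simp only [CharP.cast_eq_zero, zero_mul, mul_zero, add_zero, Nat.add_sub_cancel]
    refine sum_congr rfl fun l _ => ?_
    push_cast
    ring
  have hm' := sum_congr (s₁ := range N) rfl fun l _ => hm l
  rw [sum_comm, sum_comm (s := range N)] at hm'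
  have hl' := sum_congr (s₁ := range (n + 1)) rfl fun m _ => hl m
  calc _ = ∑ m ∈ range (n + 1), ∑ l ∈ range N, g m l *
        ((m + l + r₁) * (m + l + r₂) * V m l +
        (t - 1) * (m * (m - 1 + s₂)) * V (m - 1) l - t * (l * (l - 1 + s₁)) * V m (l - 1)) := by
        simp only [← hterm, mul_sum, ← sum_add_distrib, ← sum_sub_distrib]
        refine sum_congr rfl fun m _ => sum_congr rfl fun l _ => ?_
        ring
    _ = ∑ m ∈ range (n + 1), ∑ l ∈ range N, ((m + l + r₁) * (m + l + r₂) * g m l +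
          (t - 1) * (((m : ℂ) + 1) * (m + s₂)) * g (m + 1) l -
          t * (((l : ℂ) + 1) * (l + s₁)) * g m (l + 1)) * V m l := by
        simp only [mul_sub (g _ _), mul_add (g _ _), sum_add_distrib, sum_sub_distrib]
        rw [hm', hl', ← sum_add_distrib, ← sum_sub_distrib]
        refine sum_congr rfl fun m _ => ?_
        rw [← sum_add_distrib, ← sum_sub_distrib]
        refine sum_congr rfl fun l _ => ?_
        ring
    _ = 0 := by
        refine sum_eq_zero fun m _ => sum_eq_zero fun l _ => ?_
        rw [hrec, sub_self, zero_mul]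


/-! ### Gauss hypergeometric coefficients and their recurrences. -/

/-- The rising factorial `a (a + 1) ⋯ (a + n - 1)`. -/
def rising (a : ℂ) (n : ℕ) : ℂ := ∏ k ∈ range n, (a + k)

theorem rising_succ (a : ℂ) (n : ℕ) : rising a (n + 1) = rising a n * (a + n) :=
  prod_range_succ _ _

theorem rising_ne_zero {a : ℂ} (ha : ∀ n : ℕ, a ≠ -(n : ℂ)) (n : ℕ) : rising a n ≠ 0 :=
  prod_ne_zero_iff.2 fun k _ h => ha k (eq_neg_of_add_eq_zero_left h)

theorem rising_add (a : ℂ) (m n : ℕ) : rising a (m + n) = rising a m * rising (a + m) n := by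
  rw [rising, prod_range_add]
  simp only [rising, Nat.cast_add, add_assoc]

theorem rising_neg_eq_zero {n m : ℕ} (h : n < m) : rising (-(n : ℂ)) m = 0 :=
  prod_eq_zero (mem_range.2 h) (neg_add_cancel _)

theorem ascPochhammer_eval_eq_rising (a : ℂ) (n : ℕ) :
    (ascPochhammer ℂ n).eval a = rising a n := by
  induction n with
  | zero => simp [rising]
  | succ n ih => rw [ascPochhammer_succ_eval, ih, rising_succ]

/-- The coefficient of `u ^ n` in `F(a, b, c, u)`. -/
def hypCoeff (a b c : ℂ) (n : ℕ) : ℂ := rising a n * rising b n / (rising c n * n.factorial)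

theorem ordinaryHypergeometric_eq_tsum_hypCoeff (a b c x : ℂ) :
    ordinaryHypergeometric a b c x = ∑' n, hypCoeff a b c n * x ^ n := by
  rw [ordinaryHypergeometric_eq_tsum]
  refine tsum_congr fun n => ?_
  simp only [ascPochhammer_eval_eq_rising, smul_eq_mul, hypCoeff, div_eq_mul_inv, mul_inv]
  ring

theorem hypCoeff_zero (a b c : ℂ) : hypCoeff a b c 0 = 1 := by
  simp [hypCoeff, rising]

theorem hypCoeff_succ (a b : ℂ) {c : ℂ} (hc : ∀ n : ℕ, c ≠ -(n : ℂ)) (n : ℕ) :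
    ((n : ℂ) + 1) * (c + n) * hypCoeff a b c (n + 1) = (a + n) * (b + n) * hypCoeff a b c n := by
  have h1 := rising_ne_zero hc n
  have h2 : c + n ≠ 0 := fun h => hc n (eq_neg_of_add_eq_zero_left h)
  have h3 : ((n.factorial : ℕ) : ℂ) ≠ 0 := Nat.cast_ne_zero.2 n.factorial_ne_zero
  have h4 : (n : ℂ) + 1 ≠ 0 := Nat.cast_add_one_ne_zero n
  rw [hypCoeff, hypCoeff, rising_succ, rising_succ, rising_succ, Nat.factorial_succ]
  push_cast
  field_simp

theorem hypCoeff_neg_eq_zero {n m : ℕ} (b c : ℂ) (h : n < m) : hypCoeff (-(n : ℂ)) b c m = 0 := by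
  rw [hypCoeff, rising_neg_eq_zero h, zero_mul, zero_div]

theorem summable_norm_hypCoeff (a b : ℂ) {c x : ℂ} (hc : ∀ n : ℕ, c ≠ -(n : ℂ)) (hx : ‖x‖ < 1) :
    Summable fun n => ‖hypCoeff a b c n * x ^ n‖ := by
  have hlim : Filter.Tendsto (fun n : ℕ => ‖(a + n) / (1 + n) * ((b + n) / (c + n)) * x‖)
      Filter.atTop (nhds ‖x‖) := by
    have h1 := tendsto_add_mul_div_add_mul_atTop_nhds (𝕜 := ℂ) a 1 1 one_ne_zero
    have h2 := tendsto_add_mul_div_add_mul_atTop_nhds (𝕜 := ℂ) b c 1 one_ne_zero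
    simpa using ((h1.mul h2).mul_const x).norm
  obtain ⟨r, hxr, hr1⟩ := exists_between hx
  refine summable_of_ratio_norm_eventually_le hr1 ?_
  filter_upwards [hlim.eventually_le_const hxr] with n hn
  have h2 : c + n ≠ 0 := fun h => hc n (eq_neg_of_add_eq_zero_left h)
  have h4 : (1 : ℂ) + n ≠ 0 := by
    rw [add_comm]
    exact Nat.cast_add_one_ne_zero n
  have e : hypCoeff a b c (n + 1) * x ^ (n + 1) =
      ((a + n) / (1 + n) * ((b + n) / (c + n)) * x) * (hypCoeff a b c n * x ^ n) := by
    have h := hypCoeff_succ a b hc n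
    field_simp
    linear_combination x ^ (n + 1) * h
  rw [norm_norm, norm_norm, e, norm_mul]
  exact mul_le_mul_of_nonneg_right hn (norm_nonneg _)

/-- The coefficients of `(w - 1) ^ k * ∑ H_l w ^ l`. -/
def subOnePowCoeff (H : ℕ → ℂ) : ℕ → ℕ → ℂ
  | 0, l => H l
  | k + 1, 0 => -subOnePowCoeff H k 0
  | k + 1, l + 1 => subOnePowCoeff H k l - subOnePowCoeff H k (l + 1)

theorem subOnePowCoeff_zero_right (H : ℕ → ℂ) (k : ℕ) :
    subOnePowCoeff H k 0 = (-1) ^ k * H 0 := by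
  induction k with
  | zero => simp [subOnePowCoeff]
  | succ k ih =>
    rw [subOnePowCoeff, ih]
    ring

theorem hasSum_subOnePowCoeff {H : ℕ → ℂ} {w : ℂ} (hH : Summable fun l => ‖H l * w ^ l‖) (k : ℕ) :
    (Summable fun l => ‖subOnePowCoeff H k l * w ^ l‖) ∧
      HasSum (fun l => subOnePowCoeff H k l * w ^ l) ((w - 1) ^ k * ∑' l, H l * w ^ l) := by
  induction k with
  | zero =>
    simp only [subOnePowCoeff, pow_zero, one_mul]
    exact ⟨hH, hH.of_norm.hasSum⟩
  | succ k ih =>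
    obtain ⟨h1, h2⟩ := ih
    have e : ∀ l, subOnePowCoeff H (k + 1) (l + 1) * w ^ (l + 1) =
        w * (subOnePowCoeff H k l * w ^ l) - subOnePowCoeff H k (l + 1) * w ^ (l + 1) := by
      intro l
      rw [subOnePowCoeff]
      ring
    have h3 := (hasSum_nat_add_iff' 1).2 h2
    rw [sum_range_one] at h3
    constructor
    · rw [← summable_nat_add_iff 1]
      refine ((h1.mul_left ‖w‖).add ((summable_nat_add_iff 1).2 h1)).of_nonneg_of_le
        (fun _ => norm_nonneg _) fun l => ?_
      rw [e, ← norm_mul]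
      exact norm_sub_le _ _
    · rw [← hasSum_nat_add_iff' 1, sum_range_one]
      refine HasSum.congr_fun ?_ e
      convert! (h2.mul_left w).sub h3 using 1
      rw [subOnePowCoeff]
      ring

/-- The differential equation of `(w - 1) ^ k F(a, b, c, w)`. -/
theorem subOnePowCoeff_hypCoeff (a b : ℂ) {c : ℂ} (hc : ∀ n : ℕ, c ≠ -(n : ℂ)) (k l : ℕ) :
    ((l : ℂ) + 1) * (c + l) * subOnePowCoeff (hypCoeff a b c) k (l + 1) =
      (l + a - k) * (l + b - k) * subOnePowCoeff (hypCoeff a b c) k l -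
        k * (a + b - c - k) * subOnePowCoeff (hypCoeff a b c) (k - 1) l := by
  -- Multiplying by w - 1 subtracts the recurrence at l from the one at l - 1. The truncated k - 1
  -- carries the factor k, so its value at k = 0 is irrelevant.
  induction k generalizing l with
  | zero =>
    simp only [subOnePowCoeff]
    rw [hypCoeff_succ a b hc]
    push_cast
    ring
  | succ k ih =>
    rw [Nat.add_sub_cancel]
    rcases l with _ | l
    · have h := ih 0
      simp only [subOnePowCoeff] at h ⊢
      rcases k with _ | k
      · simp only [subOnePowCoeff] at h ⊢
        push_cast at h ⊢
        linear_combination -h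
      · simp only [subOnePowCoeff, Nat.add_sub_cancel] at h ⊢
        push_cast at h ⊢
        linear_combination -h
    · have h := ih (l + 1)
      have h' := ih l
      simp only [subOnePowCoeff] at h h' ⊢
      rcases k with _ | k
      · simp only [subOnePowCoeff] at h h' ⊢
        push_cast at h h' ⊢
        linear_combination h' - h
      · simp only [subOnePowCoeff, Nat.add_sub_cancel] at h h' ⊢
        push_cast at h h' ⊢
        linear_combination h' - h

/-! ### Separated solutions. -/

/-- The coefficients of the separated solution in powers of `(x₁ - 1)(x₂ - 1)` and `x₁ x₂`. -/
def separatedCoeff (t s₁ s₂ r₁ r₂ : ℂ) (n m l : ℕ) : ℂ :=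
  hypCoeff (-(n : ℂ)) (r₁ + r₂ - s₁ + n) s₂ m *
    subOnePowCoeff (hypCoeff (r₁ + n) (r₂ + n) s₁) (n - m) l * (((t - 1) ^ m)⁻¹ * (t ^ l)⁻¹)

theorem separatedCoeff_eq_zero (t s₁ s₂ r₁ r₂ : ℂ) {n m : ℕ} (l : ℕ) (h : n < m) :
    separatedCoeff t s₁ s₂ r₁ r₂ n m l = 0 := by
  rw [separatedCoeff, hypCoeff_neg_eq_zero _ _ h, zero_mul, zero_mul]

/-- With k = n - m, the equation of (w-1)^k F(r₁+n, r₂+n, s₁, w) has an extra term with factor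
k(r₁+r₂-s₁+n+m) = -(-n+m)(d+n+m). This is minus the factor in the recurrence of F(-n, d+n, s₂, ·),
so the extra term turns into the one with m + 1. -/
theorem separatedCoeff_recurrence {t s₁ s₂ : ℂ} (r₁ r₂ : ℂ) (ht₀ : t ≠ 0) (ht₁ : t ≠ 1)
    (hs₁ : ∀ n : ℕ, s₁ ≠ -(n : ℂ)) (hs₂ : ∀ n : ℕ, s₂ ≠ -(n : ℂ)) (n m l : ℕ) :
    t * (((l : ℂ) + 1) * (l + s₁)) * separatedCoeff t s₁ s₂ r₁ r₂ n m (l + 1) =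
      (m + l + r₁) * (m + l + r₂) * separatedCoeff t s₁ s₂ r₁ r₂ n m l +
        (t - 1) * (((m : ℂ) + 1) * (m + s₂)) * separatedCoeff t s₁ s₂ r₁ r₂ n (m + 1) l := by
  rcases lt_or_ge n m with h | h
  · simp [separatedCoeff_eq_zero _ _ _ _ _ _ h,
      separatedCoeff_eq_zero _ _ _ _ _ _ (h.trans m.lt_succ_self)]
  obtain ⟨k, rfl⟩ := Nat.exists_eq_add_of_le h
  have ht : t - 1 ≠ 0 := sub_ne_zero.2 ht₁
  have e1 := hypCoeff_succ (-((m + k : ℕ) : ℂ)) (r₁ + r₂ - s₁ + (m + k : ℕ)) hs₂ m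
  have e2 := subOnePowCoeff_hypCoeff (r₁ + (m + k : ℕ)) (r₂ + (m + k : ℕ)) hs₁ k l
  simp only [separatedCoeff]
  rw [show m + k - m = k by omega, show m + k - (m + 1) = k - 1 by omega]
  generalize subOnePowCoeff (hypCoeff (r₁ + (m + k : ℕ)) (r₂ + (m + k : ℕ)) s₁) = ψ at *
  generalize hypCoeff (-((m + k : ℕ) : ℂ)) (r₁ + r₂ - s₁ + (m + k : ℕ)) s₂ = α at *
  push_cast at e1 e2
  rw [pow_succ t l, pow_succ (t - 1) m, mul_inv (t ^ l), mul_inv ((t - 1) ^ m)]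
  generalize (t ^ l)⁻¹ = T
  generalize ((t - 1) ^ m)⁻¹ = U
  have hT : t * t⁻¹ = 1 := mul_inv_cancel₀ ht₀
  have hU : (t - 1) * (t - 1)⁻¹ = 1 := mul_inv_cancel₀ ht
  linear_combination (((l : ℂ) + 1) * (l + s₁) * α m * ψ k (l + 1) * U * T) * hT -
    (((m : ℂ) + 1) * (m + s₂) * α (m + 1) * ψ (k - 1) l * U * T) * hU +
    α m * U * T * e2 - ψ (k - 1) l * U * T * e1

/-- At x₂ = 0 only l = 0 survives and the factor in w reduces to a sign, leaving a Jacobi polynomial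
in (x₁-1)/(t-1). -/
theorem productArray_separatedCoeff_zero (t s₁ s₂ r₁ r₂ : ℂ) (n i : ℕ) :
    productArray n (separatedCoeff t s₁ s₂ r₁ r₂ n) i 0 =
      (-1) ^ n * ∑ m ∈ range (n + 1), hypCoeff (-(n : ℂ)) (r₁ + r₂ - s₁ + n) s₂ m *
        (((t - 1) ^ m)⁻¹ * shiftedBinomial m 0 i) := by
  rw [productArray, mul_sum]
  refine sum_congr rfl fun m hm => ?_
  have hm' : m ≤ n := Nat.lt_succ_iff.1 (mem_range.1 hm)
  have h0 : shiftedBinomial m 0 0 = (-1) ^ m := by simp [shiftedBinomial_eq]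
  rw [zero_add, sum_range_one, separatedCoeff, subOnePowCoeff_zero_right, hypCoeff_zero, h0]
  have : (-1 : ℂ) ^ n = (-1) ^ (n - m) * (-1) ^ m := by
    rw [← pow_add, Nat.sub_add_cancel hm']
  rw [this]
  simp
  ring

theorem hasSum_of_summable_prod {α β : Type*} {F : α × β → ℂ} {a : α → ℂ} {b : β → ℂ}
    (hF : Summable F) (ha : ∀ x, HasSum (fun y => F (x, y)) (a x))
    (hb : ∀ y, HasSum (fun x => F (x, y)) (b y)) : HasSum b (∑' x, a x) := by
  rw [(hF.hasSum.prod_fiberwise ha).tsum_eq]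
  exact ((Equiv.prodComm β α).hasSum_iff.2 hF.hasSum).prod_fiberwise hb

theorem hasSum_productArray {n : ℕ} {g : ℕ → ℕ → ℂ} {x₁ x₂ : ℂ}
    (hg : ∀ m, Summable fun l => ‖g m l * (x₁ * x₂) ^ l‖) :
    HasSum (fun q : ℕ × ℕ => productArray n g q.1 q.2 * (x₁ ^ q.1 * x₂ ^ q.2))
      (∑ m ∈ range (n + 1), (∑' l, g m l * (x₁ * x₂) ^ l) * ((x₁ - 1) * (x₂ - 1)) ^ m) := by
  simp only [productArray, sum_mul]
  refine hasSum_sum fun m _ => ?_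
  set F : ℕ × ℕ × ℕ → ℂ := fun p =>
    g m p.1 * ((shiftedBinomial m p.1 p.2.1 * x₁ ^ p.2.1) *
      (shiftedBinomial m p.1 p.2.2 * x₂ ^ p.2.2)) with hF
  have hnorm : ∀ (x : ℂ) (l : ℕ),
      HasSum (fun i => ‖shiftedBinomial m l i * x ^ i‖) ((‖x‖ + 1) ^ m * ‖x‖ ^ l) := fun x l => by
    simpa only [norm_mul, norm_pow] using hasSum_norm_shiftedBinomial m l ‖x‖
  have hin : ∀ l, HasSum (fun q : ℕ × ℕ => F (l, q))
      (g m l * (((x₁ - 1) ^ m * x₁ ^ l) * ((x₂ - 1) ^ m * x₂ ^ l))) := by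
    intro l
    have hs : Summable fun q : ℕ × ℕ => (shiftedBinomial m l q.1 * x₁ ^ q.1) *
        (shiftedBinomial m l q.2 * x₂ ^ q.2) :=
      summable_mul_of_summable_norm (f := fun i => shiftedBinomial m l i * x₁ ^ i)
        (g := fun i => shiftedBinomial m l i * x₂ ^ i) (hnorm x₁ l).summable (hnorm x₂ l).summable
    have h := (hasSum_shiftedBinomial m l x₁).mul (hasSum_shiftedBinomial m l x₂) hs
    exact h.mul_left (g m l)
  have hinn : ∀ l, HasSum (fun q : ℕ × ℕ => ‖F (l, q)‖)
      (‖g m l‖ * (((‖x₁‖ + 1) ^ m * ‖x₁‖ ^ l) * ((‖x₂‖ + 1) ^ m * ‖x₂‖ ^ l))) := fun l => by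
    simp only [hF, norm_mul (g m l), norm_mul (shiftedBinomial m l _ * x₁ ^ _)]
    exact ((hnorm x₁ l).mul (hnorm x₂ l) ((hnorm x₁ l).summable.mul_of_nonneg
      (hnorm x₂ l).summable (fun _ => norm_nonneg _) fun _ => norm_nonneg _)).mul_left _
  -- The inner sums of norms over i and j contribute a constant times |x₁x₂|^l, so `hg` suffices.
  have hsum : Summable F := by
    refine Summable.of_norm ((summable_prod_of_nonneg fun _ => norm_nonneg _).2
      ⟨fun l => (hinn l).summable, ?_⟩)
    refine ((hg m).mul_left ((‖x₁‖ + 1) ^ m * (‖x₂‖ + 1) ^ m)).congr fun l => ?_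
    rw [(hinn l).tsum_eq, norm_mul, norm_pow, norm_mul, mul_pow]
    ring
  have hout : ∀ q : ℕ × ℕ, HasSum (fun l => F (l, q)) ((∑ l ∈ range (q.2 + 1),
      g m l * (shiftedBinomial m l q.1 * shiftedBinomial m l q.2)) * (x₁ ^ q.1 * x₂ ^ q.2)) := by
    intro q
    have e : (∑ l ∈ range (q.2 + 1),
        g m l * (shiftedBinomial m l q.1 * shiftedBinomial m l q.2)) * (x₁ ^ q.1 * x₂ ^ q.2) =
        ∑ l ∈ range (q.2 + 1), F (l, q) := by
      rw [sum_mul]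
      refine sum_congr rfl fun l _ => ?_
      simp only [hF]
      ring
    rw [e]
    refine hasSum_sum_of_ne_finset_zero fun l hl => ?_
    simp only [hF]
    rw [shiftedBinomial_eq_zero (i := q.2) (by simpa using hl)]
    ring
  have hval : ∑' l, g m l * (((x₁ - 1) ^ m * x₁ ^ l) * ((x₂ - 1) ^ m * x₂ ^ l)) =
      (∑' l, g m l * (x₁ * x₂) ^ l) * ((x₁ - 1) * (x₂ - 1)) ^ m := by
    rw [← tsum_mul_right]
    refine tsum_congr fun l => ?_
    rw [mul_pow, mul_pow]
    ring
  rw [← hval]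
  simp only [← sum_mul]
  exact hasSum_of_summable_prod hsum hin hout

/-- The separated solution as a convergent double series. -/
theorem hasSum_productArray_separatedCoeff {t s₁ s₂ : ℂ} (r₁ r₂ : ℂ) (ht₀ : t ≠ 0) (ht₁ : t ≠ 1)
    (hs₁ : ∀ n : ℕ, s₁ ≠ -(n : ℂ)) (n : ℕ) {x₁ x₂ : ℂ} (hx : ‖x₁ * x₂‖ < ‖t‖) :
    HasSum (fun q : ℕ × ℕ =>
        productArray n (separatedCoeff t s₁ s₂ r₁ r₂ n) q.1 q.2 * (x₁ ^ q.1 * x₂ ^ q.2))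
      (ordinaryHypergeometric (-(n : ℂ)) (r₁ + r₂ - s₁ + n) s₂
          (t * (x₁ - 1) * (x₂ - 1) / ((t - 1) * (x₁ * x₂ - t))) *
        ordinaryHypergeometric (r₁ + (n : ℂ)) (r₂ + (n : ℂ)) s₁ (x₁ * x₂ / t) *
        (x₁ * x₂ / t - 1) ^ n) := by
  have ht : t - 1 ≠ 0 := sub_ne_zero.2 ht₁
  have hw : ‖x₁ * x₂ / t‖ < 1 := by
    rw [norm_div, div_lt_one (norm_pos_iff.2 ht₀)]
    exact hx
  have hw1 : x₁ * x₂ / t - 1 ≠ 0 := fun h => by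
    rw [sub_eq_zero.1 h, norm_one] at hw
    exact lt_irrefl _ hw
  set w := x₁ * x₂ / t with hwdef
  have hH := summable_norm_hypCoeff (r₁ + n) (r₂ + n) hs₁ hw
  have hterm : ∀ m l, separatedCoeff t s₁ s₂ r₁ r₂ n m l * (x₁ * x₂) ^ l =
      (hypCoeff (-(n : ℂ)) (r₁ + r₂ - s₁ + n) s₂ m * ((t - 1) ^ m)⁻¹) *
        (subOnePowCoeff (hypCoeff (r₁ + n) (r₂ + n) s₁) (n - m) l * w ^ l) := by
    intro m l
    rw [separatedCoeff, hwdef, div_pow, div_eq_mul_inv]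
    ring
  have hsum := hasSum_productArray (n := n) (g := separatedCoeff t s₁ s₂ r₁ r₂ n)
    (x₁ := x₁) (x₂ := x₂) fun m => by
      simp only [hterm, norm_mul (hypCoeff _ _ _ _ * _)]
      exact (hasSum_subOnePowCoeff hH (n - m)).1.mul_left _
  convert! hsum using 1
  -- In terms of w the m-th power of this argument has denominator (w-1)^m, absorbed by (w-1)^n
  -- because m ≤ n.
  have hz : t * (x₁ - 1) * (x₂ - 1) / ((t - 1) * (x₁ * x₂ - t)) =
      (x₁ - 1) * (x₂ - 1) / ((t - 1) * (w - 1)) := by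
    have h1 : x₁ * x₂ - t = t * (w - 1) := by
      rw [hwdef]
      field_simp
    rw [h1]
    field_simp
  rw [hz, ordinaryHypergeometric_eq_tsum_hypCoeff (-(n : ℂ)),
    tsum_eq_sum (s := range (n + 1)) fun m hm => by
      rw [hypCoeff_neg_eq_zero _ _ (by simpa using hm), zero_mul],
    ordinaryHypergeometric_eq_tsum_hypCoeff, sum_mul, sum_mul]
  refine sum_congr rfl fun m hm => ?_
  have hm' : m ≤ n := Nat.lt_succ_iff.1 (mem_range.1 hm)
  simp only [hterm]
  rw [tsum_mul_left, (hasSum_subOnePowCoeff hH (n - m)).2.tsum_eq]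
  have : (w - 1) ^ n = (w - 1) ^ (n - m) * (w - 1) ^ m := by
    rw [← pow_add, Nat.sub_add_cancel hm']
  rw [this, div_pow, mul_pow (t - 1)]
  field_simp


/-! ### Expansion of powers in Jacobi polynomials. -/

theorem rising_neg_natCast (n m : ℕ) :
    rising (-(n : ℂ)) m = (-1) ^ m * (m.factorial * n.choose m : ℂ) := by
  rw [← Nat.cast_mul, ← Nat.descFactorial_eq_factorial_mul_choose]
  induction m with
  | zero => simp [rising]
  | succ m ih =>
    rw [rising_succ, ih, Nat.descFactorial_succ]
    rcases le_or_gt m n with h | h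
    · rw [Nat.cast_mul, Nat.cast_sub h]
      ring
    · simp [Nat.descFactorial_of_lt h]

theorem rising_natCast_add_one (n l : ℕ) :
    rising ((n : ℂ) + 1) l = l.factorial * (n + l).choose l := by
  rw [← Nat.cast_mul, ← Nat.ascFactorial_eq_factorial_mul_choose]
  induction l with
  | zero => simp [rising]
  | succ l ih =>
    rw [rising_succ, ih, Nat.ascFactorial_succ]
    push_cast
    ring

theorem hypCoeff_neg_natCast (n m : ℕ) (b c : ℂ) :
    hypCoeff (-(n : ℂ)) b c m = (-1) ^ m * (n.choose m : ℂ) * (rising b m / rising c m) := by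
  have h : ((m.factorial : ℕ) : ℂ) ≠ 0 := Nat.cast_ne_zero.2 m.factorial_ne_zero
  rw [hypCoeff, rising_neg_natCast]
  field_simp

theorem hypCoeff_natCast_add_one (n l : ℕ) (b c : ℂ) :
    hypCoeff ((n : ℂ) + 1) b c l = ((n + l).choose l : ℂ) * (rising b l / rising c l) := by
  have h : ((l.factorial : ℕ) : ℂ) ≠ 0 := Nat.cast_ne_zero.2 l.factorial_ne_zero
  rw [hypCoeff, rising_natCast_add_one]
  field_simp

theorem rising_zero (a : ℂ) : rising a 0 = 1 := by simp [rising]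

theorem ne_neg_natCast_add {c : ℂ} (hc : ∀ n : ℕ, c ≠ -(n : ℂ)) (m : ℕ) :
    ∀ n : ℕ, c + m ≠ -(n : ℂ) := fun n h => hc (n + m) (by
  push_cast
  linear_combination h)

/-- Here d = 0 is allowed: the product is empty for n = 0, and for n ≥ 1 its factors start at d + 1
or later. -/
theorem rising_add_self_ne_zero {d : ℂ} (hd : ∀ n : ℕ, d + 1 ≠ -(n : ℂ)) (n : ℕ) :
    rising (d + n) n ≠ 0 := by
  rcases n with _ | n
  · simp [rising]
  · have h := rising_ne_zero (ne_neg_natCast_add hd n) (n + 1)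
    rwa [show d + ((n + 1 : ℕ) : ℂ) = d + 1 + n by push_cast; ring]

/-- The partial sums have a closed form, hence the induction on K. For K = M + 1 the right side
vanishes, which is the orthogonality needed below. -/
theorem sum_alternating_choose_div_rising {D : ℂ} (hD : ∀ n : ℕ, D + 1 ≠ -(n : ℂ)) (M K : ℕ)
    (hK : K ≤ M + 1) :
    ∑ k ∈ range (K + 1), (-1 : ℂ) ^ k * ((M + 1).choose k : ℂ) /
        (rising (D + k) k * rising (D + 2 * k + 1) (M + 1 - k)) =
      (-1) ^ K * (M.choose K : ℂ) / rising (D + K + 1) (M + 1) := by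
  induction K with
  | zero => simp [rising]
  | succ K ih =>
    rw [sum_range_succ, ih (by omega)]
    have hne : ∀ k n : ℕ, rising (D + 1 + k) n ≠ 0 := fun k n =>
      rising_ne_zero (ne_neg_natCast_add hD k) n
    obtain ⟨j, rfl⟩ := Nat.exists_eq_add_of_le (Nat.le_of_succ_le_succ hK)
    rw [show K + j + 1 - (K + 1) = j by omega]
    have e0 : D + ((K + 1 : ℕ) : ℂ) = D + 1 + K := by push_cast; ring
    have e1 : D + 2 * ((K + 1 : ℕ) : ℂ) + 1 = D + 1 + (2 * K + 1 + 1 : ℕ) := by push_cast; ring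
    have e2 : D + K + 1 = D + 1 + K := by ring
    have e3 : D + 1 + K + 1 = D + 1 + (K + 1 : ℕ) := by push_cast; ring
    rw [e0, e1, e2, e3]
    set A := rising (D + 1 + K) (K + 1)
    set B := rising (D + 1 + (2 * K + 1 + 1 : ℕ)) j
    have hA : A ≠ 0 := hne _ _
    have hB : B ≠ 0 := hne _ _
    have hmid : D + 1 + (2 * K + 1 : ℕ) ≠ 0 := fun h => hD (2 * K + 1) (eq_neg_of_add_eq_zero_left h)
    have hlast : D + 1 + ((K : ℂ) + (K + j + 1 : ℕ)) ≠ 0 := fun h => hD (K + (K + j + 1)) (by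
      push_cast at h ⊢
      linear_combination h)
    have hfirst : D + 1 + K ≠ 0 := fun h => hD K (eq_neg_of_add_eq_zero_left h)
    -- Both denominators divide one longer rising factorial; `r1` and `r2` compare them with P times
    -- its last factor.
    have r1 : A * (D + 1 + (2 * K + 1 : ℕ)) * B =
        rising (D + 1 + K) (K + j + 1) * (D + 1 + ((K : ℂ) + (K + j + 1 : ℕ))) := by
      have h1 := rising_add (D + 1 + K) (K + 1) (1 + j)
      rw [rising_add (D + 1 + K + (K + 1 : ℕ)) 1 j, show K + 1 + (1 + j) = K + j + 1 + 1 by ring,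
        rising_succ] at h1
      have h2 : rising (D + 1 + K + (K + 1 : ℕ)) 1 = D + 1 + (2 * K + 1 : ℕ) := by
        simp only [rising, prod_range_one]
        push_cast
        ring
      rw [h2, show D + 1 + K + ((K + 1 : ℕ) : ℂ) + (1 : ℕ) = D + 1 + (2 * K + 1 + 1 : ℕ) by
        push_cast; ring] at h1
      linear_combination -h1
    have r2 : rising (D + 1 + K) (K + j + 1) * (D + 1 + ((K : ℂ) + (K + j + 1 : ℕ))) =
        (D + 1 + K) * rising (D + 1 + (K + 1 : ℕ)) (K + j + 1) := by
      have h1 := rising_add (D + 1 + K) 1 (K + j + 1)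
      rw [show 1 + (K + j + 1) = K + j + 1 + 1 by ring, rising_succ] at h1
      have h2 : rising (D + 1 + K) 1 = D + 1 + K := by simp [rising]
      rw [h2, show D + 1 + (K : ℂ) + (1 : ℕ) = D + 1 + (K + 1 : ℕ) by push_cast; ring] at h1
      linear_combination h1
    have hP := hne K (K + j + 1)
    have hQ := hne (K + 1) (K + j + 1)
    set P := rising (D + 1 + K) (K + j + 1)
    set Q := rising (D + 1 + (K + 1 : ℕ)) (K + j + 1)
    have q1 : 1 / (A * B) = (D + 1 + (2 * K + 1 : ℕ)) /
        (P * (D + 1 + ((K : ℂ) + (K + j + 1 : ℕ)))) := by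
      rw [← r1]
      field_simp
    have q2 : 1 / Q = (D + 1 + K) / (P * (D + 1 + ((K : ℂ) + (K + j + 1 : ℕ)))) := by
      rw [r2]
      field_simp
    rw [div_eq_mul_one_div _ (A * B), q1, div_eq_mul_one_div _ Q, q2]
    have c1 : ((K + j + 1).choose (K + 1) : ℂ) = (K + j).choose K + (K + j).choose (K + 1) := by
      exact_mod_cast Nat.choose_succ_succ (K + j) K
    have c2 : ((K + j).choose (K + 1) : ℂ) * (K + 1) = (K + j).choose K * j := by
      have := Nat.choose_succ_right_eq (K + j) K
      rw [Nat.add_sub_cancel_left] at this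
      exact_mod_cast this
    rw [c1]
    field_simp
    push_cast
    linear_combination (-1) ^ (K + 1) * c2

/-- The biorthogonality that expands powers in Jacobi polynomials. -/
theorem sum_range_jacobi {b d : ℂ} (hb : ∀ n : ℕ, b ≠ -(n : ℂ)) (hd : ∀ n : ℕ, d + 1 ≠ -(n : ℂ))
    {m N : ℕ} (hm : m ≤ N) :
    ∑ n ∈ range (N + 1), rising b n / rising (d + n) n *
        hypCoeff ((n : ℂ) + 1) (b + n) (d + 2 * n + 1) (N - n) *
        ((-1) ^ n * hypCoeff (-(n : ℂ)) (d + n) b m) = if m = N then 1 else 0 := by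
  obtain ⟨M, rfl⟩ := Nat.exists_eq_add_of_le hm
  have hb' := rising_ne_zero hb
  -- Only n = m + k with k ≥ 0 contributes. The rising factorials in b merge, leaving the
  -- alternating sum above with D = d + 2m.
  have hterm : ∀ k ∈ range (M + 1),
      rising b (m + k) / rising (d + (m + k : ℕ)) (m + k) *
        hypCoeff (((m + k : ℕ) : ℂ) + 1) (b + (m + k : ℕ)) (d + 2 * (m + k : ℕ) + 1)
          (m + M - (m + k)) *
        ((-1) ^ (m + k) * hypCoeff (-((m + k : ℕ) : ℂ)) (d + (m + k : ℕ)) b m) =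
      (rising b (m + M) / rising b m * (m + M).choose m) *
        ((-1 : ℂ) ^ k * (M.choose k : ℂ) /
        (rising (d + 2 * m + k) k * rising (d + 2 * m + 2 * k + 1) (M - k))) := by
    intro k hk
    obtain ⟨j, rfl⟩ := Nat.exists_eq_add_of_le (Nat.lt_succ_iff.1 (mem_range.1 hk))
    rw [show m + (k + j) - (m + k) = j by omega, Nat.add_sub_cancel_left, hypCoeff_neg_natCast,
      hypCoeff_natCast_add_one]
    have h1 : rising b (m + (k + j)) = rising b (m + k) * rising (b + (m + k : ℕ)) j := by
      rw [← rising_add, add_assoc]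
    have h2 : rising (d + (m + k : ℕ)) (m + k) =
        rising (d + (m + k : ℕ)) m * rising (d + 2 * m + k) k := by
      rw [rising_add]
      congr 2
      push_cast
      ring
    have h3 : d + 2 * ((m + k : ℕ) : ℂ) + 1 = d + 2 * m + 2 * k + 1 := by
      push_cast
      ring
    have h4 := rising_add_self_ne_zero hd (m + k)
    rw [h2] at h4
    have h5 := left_ne_zero_of_mul h4
    have h6 := right_ne_zero_of_mul h4
    have h7 : ((m + k + j).choose j : ℂ) * (m + k).choose m =
        (m + (k + j)).choose m * (k + j).choose k := by
      have h := Nat.choose_mul (n := m + k + j) (k := m + k) (s := m) (by omega)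
      rw [show m + k + j - m = k + j by omega, Nat.add_sub_cancel_left,
        Nat.choose_symm_add (a := m + k) (b := j), add_assoc m k j] at h
      rw [add_assoc m k j]
      exact_mod_cast h
    have h8 : rising (d + 2 * m + 2 * k + 1) j ≠ 0 := by
      have h := rising_ne_zero (ne_neg_natCast_add hd (2 * m + 2 * k)) j
      rwa [show d + 2 * m + 2 * (k : ℂ) + 1 = d + 1 + (2 * m + 2 * k : ℕ) by push_cast; ring]
    have h9 : (-1 : ℂ) ^ (m + k) * (-1) ^ m = (-1) ^ k := by
      rw [← pow_add, show m + k + m = 2 * m + k by ring, pow_add, pow_mul]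
      simp
    rw [h1, h2, h3]
    have h10 := hb' m
    field_simp
    linear_combination rising b (m + k) * rising (b + (m + k : ℕ)) j *
      (((m + k + j).choose j : ℂ) * (m + k).choose m * h9 + (-1) ^ k * h7)
  have hsplit : ∑ n ∈ range (m + M + 1), rising b n / rising (d + n) n *
        hypCoeff ((n : ℂ) + 1) (b + n) (d + 2 * n + 1) (m + M - n) *
        ((-1) ^ n * hypCoeff (-(n : ℂ)) (d + n) b m) =
      (rising b (m + M) / rising b m * (m + M).choose m) * ∑ k ∈ range (M + 1),
        ((-1 : ℂ) ^ k * (M.choose k : ℂ) /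
        (rising (d + 2 * m + k) k * rising (d + 2 * m + 2 * k + 1) (M - k))) := by
    rw [add_assoc m M 1, sum_range_add, sum_eq_zero, zero_add, mul_sum]
    · exact sum_congr rfl hterm
    · intro n hn
      rw [hypCoeff_neg_eq_zero _ _ (mem_range.1 hn), mul_zero, mul_zero]
  rw [hsplit]
  rcases M with _ | M
  · simp [rising_zero, hb' m]
  · have hD : ∀ n : ℕ, d + 2 * m + 1 ≠ -(n : ℂ) := fun n h => by
      refine ne_neg_natCast_add hd (2 * m) n ?_
      push_cast
      linear_combination h
    rw [sum_alternating_choose_div_rising hD M (M + 1) le_rfl, Nat.choose_succ_self]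
    simp

/-! ### Geometric bounds for ratios of rising factorials. -/

/-- Keeping p and q separate gives one constant for ratios of rising factorials whose bases are
shifted by different multiples of n. -/
theorem exists_norm_add_mul_le (a : ℂ) {c : ℂ} (hc : ∀ n : ℕ, c ≠ -(n : ℂ)) :
    ∃ κ ≥ (1 : ℝ), ∀ p q : ℕ, ‖a + p‖ * ((q : ℝ) + 1) ≤ κ * ((p : ℝ) + 1) * ‖c + q‖ := by
  obtain ⟨δ, hδ, h⟩ := exists_mul_succ_le_norm_add hc
  refine ⟨max 1 ((‖a‖ + 1) / δ), le_max_left _ _, fun p q => ?_⟩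
  have h1 := norm_add_natCast_le a p
  have h2 : ‖a‖ + 1 ≤ max 1 ((‖a‖ + 1) / δ) * δ := by
    rw [← div_le_iff₀ hδ]
    exact le_max_right _ _
  calc ‖a + p‖ * ((q : ℝ) + 1) ≤ (‖a‖ + 1) * (p + 1) * (q + 1) := by gcongr
    _ ≤ (max 1 ((‖a‖ + 1) / δ) * δ) * (p + 1) * (q + 1) := by gcongr
    _ = max 1 ((‖a‖ + 1) / δ) * (p + 1) * (δ * (q + 1)) := by ring
    _ ≤ _ := by
      gcongr
      exact h q

theorem norm_rising_div_le_pow {a c : ℂ} {κ : ℝ} (hκ : 0 ≤ κ) {n : ℕ}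
    (h : ∀ k < n, ‖a + k‖ ≤ κ * ‖c + k‖) : ‖rising a n / rising c n‖ ≤ κ ^ n := by
  rw [rising, rising, ← prod_div_distrib, norm_prod]
  refine (prod_le_prod (fun _ _ => norm_nonneg _) (g := fun _ => κ) fun k hk => ?_).trans_eq
    (by rw [prod_const, card_range])
  rw [norm_div]
  exact div_le_of_le_mul₀ (norm_nonneg _) hκ (h k (mem_range.1 hk))

theorem norm_rising_add_div_rising_le {d b : ℂ} {κ : ℝ} (hκ : 1 ≤ κ)
    (h : ∀ p q : ℕ, ‖d + p‖ * ((q : ℝ) + 1) ≤ κ * ((p : ℝ) + 1) * ‖b + q‖) (n m : ℕ) :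
    ‖rising (d + n) m / rising b m‖ ≤ κ ^ m * (n + m).choose m := by
  have hm : ((m.factorial : ℕ) : ℝ) ≠ 0 := Nat.cast_ne_zero.2 m.factorial_ne_zero
  have e : κ ^ m * ((n + m).choose m : ℝ) =
      ∏ k ∈ range m, (κ * ((n + k : ℕ) + 1) / ((k : ℝ) + 1)) := by
    rw [prod_div_distrib, prod_mul_distrib, prod_const, card_range]
    have h1 : ∏ k ∈ range m, ((k : ℝ) + 1) = m.factorial := by
      rw [← prod_range_add_one_eq_factorial]
      push_cast
      rfl
    have h2 : ∏ k ∈ range m, (((n + k : ℕ) : ℝ) + 1) = m.factorial * (n + m).choose m := by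
      rw [← Nat.cast_mul, ← Nat.ascFactorial_eq_factorial_mul_choose,
        Nat.ascFactorial_eq_prod_range, Nat.cast_prod]
      refine prod_congr rfl fun k _ => ?_
      push_cast
      ring
    rw [h1, h2]
    field_simp
  rw [e, rising, rising, ← prod_div_distrib, norm_prod]
  refine prod_le_prod (fun _ _ => norm_nonneg _) fun k _ => ?_
  rw [norm_div, le_div_iff₀ (by positivity), div_mul_eq_mul_div]
  refine div_le_of_le_mul₀ (norm_nonneg _) (by positivity) ?_
  have := h (n + k) k
  rwa [Nat.cast_add n k, ← add_assoc] at this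

/-- The first column of the coefficient array of the separated solution. -/
def jacobiCoeff (t b d : ℂ) (n k : ℕ) : ℂ :=
  (-1) ^ n * ∑ m ∈ range (n + 1), hypCoeff (-(n : ℂ)) (d + n) b m *
    (((t - 1) ^ m)⁻¹ * shiftedBinomial m 0 k)

theorem exists_norm_jacobiCoeff_le {b : ℂ} (t d : ℂ) (hb : ∀ n : ℕ, b ≠ -(n : ℂ)) :
    ∃ Q ≥ (1 : ℝ), ∀ n k : ℕ, ‖jacobiCoeff t b d n k‖ ≤ Q ^ n := by
  obtain ⟨κ, hκ, h⟩ := exists_norm_add_mul_le d hb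
  set τ := max 1 ‖(t - 1)⁻¹‖ with hτ
  have hτ1 : 1 ≤ τ := le_max_left _ _
  -- The factors bound, in order, the number n + 1 of summands, the coefficient of F(-n, d+n, b, ·),
  -- the power of (t-1)⁻¹ and the binomial coefficient.
  refine ⟨2 * (2 * (κ * 4) * (τ * 2)), by nlinarith, fun n k => ?_⟩
  rw [jacobiCoeff, norm_mul, norm_pow, norm_neg, norm_one, one_pow, one_mul]
  refine (norm_sum_le_of_le (f := fun m => hypCoeff (-(n : ℂ)) (d + n) b m *
    (((t - 1) ^ m)⁻¹ * shiftedBinomial m 0 k)) (n := fun _ => (2 * (κ * 4) * (τ * 2)) ^ n) _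
    fun m hm => ?_).trans ?_
  · have hm' : m ≤ n := Nat.lt_succ_iff.1 (mem_range.1 hm)
    have h1 : ‖hypCoeff (-(n : ℂ)) (d + n) b m‖ ≤ 2 ^ n * (κ ^ n * 4 ^ n) := by
      rw [hypCoeff_neg_natCast, norm_mul, norm_mul, norm_pow, norm_neg, norm_one, one_pow, one_mul,
        Complex.norm_natCast]
      have c1 : (n.choose m : ℝ) ≤ 2 ^ n := by exact_mod_cast Nat.choose_le_two_pow n m
      have c2 : ((n + m).choose m : ℝ) ≤ 4 ^ n := by
        have : (n + m).choose m ≤ 2 ^ (2 * n) :=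
          (Nat.choose_le_two_pow (n + m) m).trans (Nat.pow_le_pow_right two_pos (by omega))
        rw [pow_mul] at this
        exact_mod_cast this
      have c3 := norm_rising_add_div_rising_le hκ h n m
      have c4 : κ ^ m ≤ κ ^ n := pow_le_pow_right₀ hκ hm'
      calc _ ≤ 2 ^ n * (κ ^ m * ((n + m).choose m : ℝ)) := by gcongr
        _ ≤ _ := by gcongr
    have h2 : ‖((t - 1) ^ m)⁻¹‖ ≤ τ ^ n := by
      rw [← inv_pow, norm_pow]
      exact (pow_le_pow_left₀ (norm_nonneg _) (le_max_right _ _) m).trans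
        (pow_le_pow_right₀ hτ1 hm')
    have h3 : ‖shiftedBinomial m 0 k‖ ≤ 2 ^ n :=
      (norm_shiftedBinomial_zero_le m k).trans (pow_le_pow_right₀ one_le_two hm')
    rw [norm_mul, norm_mul]
    calc _ ≤ (2 ^ n * (κ ^ n * 4 ^ n)) * (τ ^ n * 2 ^ n) := by gcongr
      _ = _ := by rw [mul_pow, mul_pow 2, mul_pow κ, mul_pow τ]
  · rw [sum_const, card_range, nsmul_eq_mul, mul_pow 2 (2 * (κ * 4) * (τ * 2))]
    gcongr
    exact_mod_cast Nat.lt_two_pow_self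

theorem exists_norm_rising_div_le (b : ℂ) {d : ℂ} (hd : ∀ n : ℕ, d + 1 ≠ -(n : ℂ)) :
    ∃ Q ≥ (1 : ℝ), (∀ n : ℕ, ‖rising b n / rising (d + n) n‖ ≤ Q ^ n) ∧
      ∀ n l : ℕ, ‖hypCoeff ((n : ℂ) + 1) (b + n) (d + 2 * n + 1) l‖ ≤ Q ^ (n + l) := by
  obtain ⟨κ, hκ, h⟩ := exists_norm_add_mul_le b hd
  have hκ0 : 0 ≤ κ := zero_le_one.trans hκ
  have h' : ∀ p q : ℕ, p ≤ q → ‖b + p‖ ≤ κ * ‖d + 1 + q‖ := fun p q hpq => by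
    have hpq' : (p : ℝ) ≤ q := by exact_mod_cast hpq
    have hq : (0 : ℝ) < (q : ℝ) + 1 := by positivity
    refine le_of_mul_le_mul_right ((h p q).trans ?_) hq
    have := mul_le_mul_of_nonneg_left (add_le_add_left hpq' 1)
      (mul_nonneg hκ0 (norm_nonneg (d + 1 + (q : ℂ))))
    linarith
  refine ⟨2 * κ, by linarith, fun n => ?_, fun n l => ?_⟩
  · refine (norm_rising_div_le_pow hκ0 fun k hk => ?_).trans
      (pow_le_pow_left₀ hκ0 (by linarith) n)
    -- Since k < n forces n ≥ 1, the denominator d + n + k is d + 1 shifted by n - 1 + k.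
    have := h' k (n - 1 + k) (by omega)
    rwa [show d + 1 + ((n - 1 + k : ℕ) : ℂ) = d + n + k by
      rw [Nat.cast_add, Nat.cast_sub (by omega)]
      push_cast
      ring] at this
  · rw [hypCoeff_natCast_add_one, norm_mul, Complex.norm_natCast, mul_pow]
    have c1 : ((n + l).choose l : ℝ) ≤ 2 ^ (n + l) := by
      exact_mod_cast Nat.choose_le_two_pow (n + l) l
    have c2 : ‖rising (b + n) l / rising (d + 2 * n + 1) l‖ ≤ κ ^ l := by
      refine norm_rising_div_le_pow hκ0 fun k _ => ?_
      have := h' (n + k) (2 * n + k) (by omega)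
      push_cast at this
      rwa [← add_assoc, show d + 1 + (2 * (n : ℂ) + k) = d + 2 * n + 1 + k by ring] at this
    have c3 : κ ^ l ≤ κ ^ (n + l) := pow_le_pow_right₀ hκ (by omega)
    exact mul_le_mul c1 (c2.trans c3) (norm_nonneg _) (by positivity)


/-! ### Expansion of 1/(y - x) in Jacobi polynomials. -/

/-- This is the coefficient of x^k in 1/(y-x) = ∑_N (x-1)^N/(y-1)^(N+1), a negative binomial series
in -1/(y-1). -/
theorem hasSum_pow_mul_shiftedBinomial {y : ℂ} (hy1 : 1 < ‖y - 1‖) (k : ℕ) :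
    HasSum (fun N => ((y - 1) ^ (N + 1))⁻¹ * shiftedBinomial N 0 k) ((y ^ (k + 1))⁻¹) := by
  have hne : y - 1 ≠ 0 := fun h => by
    rw [h, norm_zero] at hy1
    exact absurd hy1 (by norm_num)
  have hinj : Function.Injective fun n : ℕ => n + k := add_left_injective k
  rw [← hinj.hasSum_iff]
  · have hr : ‖-(y - 1)⁻¹‖ < 1 := by
      rw [norm_neg, norm_inv]
      exact inv_lt_one_of_one_lt₀ hy1
    have h := (hasSum_choose_mul_geometric_of_norm_lt_one k hr).mul_left (((y - 1) ^ (k + 1))⁻¹)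
    have e : ((y - 1) ^ (k + 1))⁻¹ * (1 / (1 - -(y - 1)⁻¹) ^ (k + 1)) = (y ^ (k + 1))⁻¹ := by
      rw [one_div, ← mul_inv, ← mul_pow, show (y - 1) * (1 - -(y - 1)⁻¹) = y by
        field_simp
        ring]
    rw [e] at h
    refine h.congr_fun fun n => ?_
    have h0 := shiftedBinomial_add (n + k) 0 k
    rw [add_zero] at h0
    rw [Function.comp_apply, h0, show n + k + k = 2 * k + n by ring, pow_add (-1 : ℂ), pow_mul,
      show n + k + 1 = k + 1 + n by ring, pow_add (y - 1), neg_pow (y - 1)⁻¹, inv_pow, mul_inv]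
    simp
    ring
  · intro N hN
    have h0 := shiftedBinomial_add N 0 k
    rw [add_zero] at h0
    rw [h0, Nat.choose_eq_zero_of_lt]
    · simp
    · by_contra h
      exact hN ⟨N - k, by simp only; omega⟩

/-- The coefficient of the separated solution of degree `n` in the expansion of the kernel. -/
def kernelCoeff (t b d y : ℂ) (n : ℕ) : ℂ :=
  1 / (y - 1) * (rising b n / rising (d + n) n) *
    ordinaryHypergeometric ((n : ℂ) + 1) (b + n) (d + 2 * n + 1) ((t - 1) / (y - 1)) *
    ((t - 1) ^ n / (y - 1) ^ n)

/-- A double sum over n ≤ N is evaluated in two ways: over n it rebuilds (x-1)^N/(y-1)^(N+1) from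
Jacobi polynomials, over N it builds the hypergeometric factor of `kernelCoeff`. The cube of Q
accounts for three factors of geometric growth, and 1/4 = (1/2)(1/2) leaves decay in both indices.
-/
theorem exists_hasSum_kernelCoeff {t b d : ℂ} (ht₁ : t ≠ 1) (hb : ∀ n : ℕ, b ≠ -(n : ℂ))
    (hd : ∀ n : ℕ, d + 1 ≠ -(n : ℂ)) :
    ∃ Q ≥ (1 : ℝ), (∀ n k : ℕ, ‖jacobiCoeff t b d n k‖ ≤ Q ^ n) ∧
      ∀ y : ℂ, 1 < ‖y - 1‖ → Q ^ 3 * ‖(t - 1) / (y - 1)‖ ≤ 1 / 4 →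
        (Summable fun n => ‖kernelCoeff t b d y n‖ * Q ^ n) ∧
        ∀ k, HasSum (fun n => kernelCoeff t b d y n * jacobiCoeff t b d n k) (y ^ (k + 1))⁻¹ := by
  obtain ⟨Q₁, hQ₁, hJ⟩ := exists_norm_jacobiCoeff_le t d hb
  obtain ⟨Q₂, hQ₂, hE, hF⟩ := exists_norm_rising_div_le b hd
  set Q := max Q₁ Q₂ with hQ
  have hQ0 : 1 ≤ Q := hQ₁.trans (le_max_left _ _)
  have hJ' : ∀ n k : ℕ, ‖jacobiCoeff t b d n k‖ ≤ Q ^ n := fun n k =>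
    (hJ n k).trans (pow_le_pow_left₀ (zero_le_one.trans hQ₁) (le_max_left _ _) n)
  have hE' : ∀ n : ℕ, ‖rising b n / rising (d + n) n‖ ≤ Q ^ n := fun n =>
    (hE n).trans (pow_le_pow_left₀ (zero_le_one.trans hQ₂) (le_max_right _ _) n)
  have hF' : ∀ n l : ℕ, ‖hypCoeff ((n : ℂ) + 1) (b + n) (d + 2 * n + 1) l‖ ≤ Q ^ (n + l) :=
    fun n l => (hF n l).trans
      (pow_le_pow_left₀ (zero_le_one.trans hQ₂) (le_max_right _ _) (n + l))
  clear_value Q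
  refine ⟨Q, hQ0, hJ', fun y hy1 hv => ?_⟩
  have hne : y - 1 ≠ 0 := fun h => by
    rw [h, norm_zero] at hy1
    exact absurd hy1 (by norm_num)
  have ht : t - 1 ≠ 0 := sub_ne_zero.2 ht₁
  set v := (t - 1) / (y - 1) with hvdef
  have hv0 : 0 ≤ ‖v‖ := norm_nonneg v
  have hQv : Q * ‖v‖ ≤ 1 / 2 := by
    have : Q * ‖v‖ ≤ Q ^ 3 * ‖v‖ :=
      mul_le_mul_of_nonneg_right (le_self_pow₀ hQ0 (by norm_num)) hv0
    linarith
  have hQpos : 0 < Q := one_pos.trans_le hQ0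
  have hterm : ∀ n l : ℕ, ‖hypCoeff ((n : ℂ) + 1) (b + n) (d + 2 * n + 1) l * v ^ l‖ ≤
      Q ^ n * (1 / 2) ^ l := fun n l => by
    rw [norm_mul, norm_pow]
    calc _ ≤ Q ^ (n + l) * ‖v‖ ^ l := by
          gcongr
          exact hF' n l
      _ = Q ^ n * (Q * ‖v‖) ^ l := by rw [pow_add, mul_pow, mul_assoc]
      _ ≤ _ := by gcongr
  have hhyp : ∀ n : ℕ, HasSum
      (fun l => hypCoeff ((n : ℂ) + 1) (b + n) (d + 2 * n + 1) l * v ^ l)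
      (ordinaryHypergeometric ((n : ℂ) + 1) (b + n) (d + 2 * n + 1) v) := fun n => by
    rw [ordinaryHypergeometric_eq_tsum_hypCoeff]
    exact (Summable.of_norm_bounded (summable_geometric_two.mul_left (Q ^ n)) (hterm n)).hasSum
  have hhypn : ∀ n : ℕ,
      ‖ordinaryHypergeometric ((n : ℂ) + 1) (b + n) (d + 2 * n + 1) v‖ ≤ Q ^ n * 2 := fun n => by
    rw [← (hhyp n).tsum_eq]
    exact tsum_of_norm_bounded (hasSum_geometric_two.mul_left (Q ^ n)) (hterm n)
  constructor
  · refine (summable_geometric_two.mul_left (‖1 / (y - 1)‖ * 2)).of_nonneg_of_le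
      (fun n => by positivity) fun n => ?_
    rw [kernelCoeff, ← div_pow, ← hvdef, norm_mul, norm_mul, norm_mul, norm_pow]
    calc _ ≤ ‖1 / (y - 1)‖ * Q ^ n * (Q ^ n * 2) * ‖v‖ ^ n * Q ^ n := by
          gcongr
          · exact hE' n
          · exact hhypn n
      _ = ‖1 / (y - 1)‖ * 2 * (Q ^ 3 * ‖v‖) ^ n := by
          rw [mul_pow, ← pow_mul, mul_comm 3 n, pow_mul]
          ring
      _ ≤ _ := by
          gcongr
          linarith
  intro k
  set F : ℕ × ℕ → ℂ := fun p => if p.2 ≤ p.1 then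
    1 / (y - 1) * (rising b p.2 / rising (d + p.2) p.2 *
      hypCoeff ((p.2 : ℂ) + 1) (b + p.2) (d + 2 * p.2 + 1) (p.1 - p.2) * v ^ p.1 *
      jacobiCoeff t b d p.2 k) else 0 with hFdef
  have hsum : Summable F := by
    refine Summable.of_norm_bounded (summable_pow_mul_pow.mul_left ‖1 / (y - 1)‖) fun p => ?_
    obtain ⟨N, n⟩ := p
    simp only [hFdef]
    split_ifs with hn
    · obtain ⟨l, rfl⟩ := Nat.exists_eq_add_of_le hn
      rw [Nat.add_sub_cancel_left, norm_mul, norm_mul, norm_mul, norm_mul, norm_pow]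
      have h1 : Q ^ n ≤ Q ^ (n + l) := pow_le_pow_right₀ hQ0 (by omega)
      calc _ ≤ ‖1 / (y - 1)‖ * (Q ^ (n + l) * Q ^ (n + l) * ‖v‖ ^ (n + l) * Q ^ (n + l)) := by
            gcongr
            · exact (hE' n).trans h1
            · exact hF' n l
            · exact (hJ' n k).trans h1
        _ = ‖1 / (y - 1)‖ * (Q ^ 3 * ‖v‖) ^ (n + l) := by
            rw [mul_pow, ← pow_mul, mul_comm 3, pow_mul]
            ring
        _ ≤ ‖1 / (y - 1)‖ * (1 / 4) ^ (n + l) := by gcongr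
        _ = ‖1 / (y - 1)‖ * ((1 / 2) ^ (n + l) * (1 / 2) ^ (n + l)) := by
            rw [← mul_pow]
            norm_num
        _ ≤ _ := by
            gcongr ‖1 / (y - 1)‖ * (_ * ?_)
            exact pow_le_pow_of_le_one (by norm_num) (by norm_num) (by omega)
    · rw [norm_zero]
      positivity
  have hrow : ∀ N, HasSum (fun n => F (N, n)) (((y - 1) ^ (N + 1))⁻¹ * shiftedBinomial N 0 k) := by
    intro N
    have e : ((y - 1) ^ (N + 1))⁻¹ * shiftedBinomial N 0 k = ∑ n ∈ range (N + 1), F (N, n) := by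
      have h1 : ∀ n ∈ range (N + 1), F (N, n) =
          ∑ m ∈ range (N + 1), 1 / (y - 1) * v ^ N * (((t - 1) ^ m)⁻¹ * shiftedBinomial m 0 k) *
            (rising b n / rising (d + n) n *
              hypCoeff ((n : ℂ) + 1) (b + n) (d + 2 * n + 1) (N - n) *
              ((-1) ^ n * hypCoeff (-(n : ℂ)) (d + n) b m)) := by
        intro n hn
        have hn' : n ≤ N := Nat.lt_succ_iff.1 (mem_range.1 hn)
        have h2 : jacobiCoeff t b d n k = ∑ m ∈ range (N + 1),
            (-1) ^ n * (hypCoeff (-(n : ℂ)) (d + n) b m *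
              (((t - 1) ^ m)⁻¹ * shiftedBinomial m 0 k)) := by
          rw [jacobiCoeff, mul_sum]
          refine sum_subset (range_subset_range.2 (by omega)) fun m _ hm => ?_
          rw [hypCoeff_neg_eq_zero _ _ (by simpa using hm), zero_mul, mul_zero]
        simp only [hFdef]
        rw [if_pos hn', h2, mul_sum, mul_sum]
        refine sum_congr rfl fun m _ => ?_
        ring
      rw [sum_congr rfl h1, sum_comm]
      simp only [← mul_sum]
      rw [sum_congr rfl fun m hm => by
        rw [sum_range_jacobi hb hd (Nat.lt_succ_iff.1 (mem_range.1 hm))]]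
      simp only [mul_ite, mul_one, mul_zero, sum_ite_eq', mem_range, Nat.lt_succ_self, if_true]
      rw [hvdef, div_pow, pow_succ]
      field_simp
    rw [e]
    refine hasSum_sum_of_ne_finset_zero fun n hn => ?_
    simp only [hFdef]
    rw [if_neg (by simpa using hn)]
  have hcol : ∀ n, HasSum (fun N => F (N, n)) (kernelCoeff t b d y n * jacobiCoeff t b d n k) := by
    intro n
    have hinj : Function.Injective fun l : ℕ => l + n := add_left_injective n
    rw [← hinj.hasSum_iff]
    · have h := (hhyp n).mul_left (1 / (y - 1) * (rising b n / rising (d + n) n) * v ^ n *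
        jacobiCoeff t b d n k)
      convert! h using 1
      · funext l
        simp only [Function.comp_apply, hFdef]
        rw [if_pos (by omega), Nat.add_sub_cancel, pow_add]
        ring
      · rw [kernelCoeff, ← div_pow, ← hvdef]
        ring
    · intro N hN
      simp only [hFdef]
      rw [if_neg]
      intro h
      exact hN ⟨N - n, by simp only; omega⟩
  have h := hasSum_of_summable_prod hsum hrow hcol
  rwa [(hasSum_pow_mul_shiftedBinomial hy1 k).tsum_eq] at h

/-! ### Interchange of summations and conclusion. -/

theorem summable_prod_mul {α : Type*} {C : α → ℂ} {E : ℕ → ℂ} {J : ℕ → α → ℂ} {Q : ℝ}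
    (hQ : 0 ≤ Q) (hC : Summable fun p => ‖C p‖) (hE : Summable fun n => ‖E n‖ * Q ^ n)
    (hJ : ∀ n p, ‖J n p‖ ≤ Q ^ n) :
    Summable fun z : α × ℕ => C z.1 * (E z.2 * J z.2 z.1) := by
  have hdom := hC.mul_of_nonneg hE (fun p => norm_nonneg _)
    fun n => mul_nonneg (norm_nonneg _) (pow_nonneg hQ n)
  refine Summable.of_norm_bounded hdom fun z => ?_
  rw [norm_mul, norm_mul]
  exact mul_le_mul_of_nonneg_left
    (mul_le_mul_of_nonneg_left (hJ _ _) (norm_nonneg _)) (norm_nonneg _)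

/-- The product formula for the separated solutions in terms of the structure constants. -/
theorem hasSum_structureConstant_mul_jacobiCoeff {t s₁ s₂ s₃ r₁ r₂ : ℂ} (ht₀ : t ≠ 0)
    (ht₁ : t ≠ 1) (hr : r₁ + r₂ = s₁ + s₂ + s₃ - 1) (hs₁ : ∀ n : ℕ, s₁ ≠ -(n : ℂ))
    (hs₂ : ∀ n : ℕ, s₂ ≠ -(n : ℂ)) (n : ℕ) {x₁ x₂ : ℂ} (hx : ‖x₁ * x₂‖ < ‖t‖)
    (hsum : Summable fun p : ℕ × ℕ × ℕ => structureConstant s₂ s₃ r₁ r₂ ht₀ hs₁ p.1 p.2.1 p.2.2 *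
      (x₁ ^ p.1 * x₂ ^ p.2.1) * jacobiCoeff t s₂ (r₁ + r₂ - s₁) n p.2.2) :
    HasSum (fun p : ℕ × ℕ × ℕ => structureConstant s₂ s₃ r₁ r₂ ht₀ hs₁ p.1 p.2.1 p.2.2 *
        (x₁ ^ p.1 * x₂ ^ p.2.1) * jacobiCoeff t s₂ (r₁ + r₂ - s₁) n p.2.2)
      (ordinaryHypergeometric (-(n : ℂ)) (r₁ + r₂ - s₁ + n) s₂
          (t * (x₁ - 1) * (x₂ - 1) / ((t - 1) * (x₁ * x₂ - t))) *
        ordinaryHypergeometric (r₁ + (n : ℂ)) (r₂ + (n : ℂ)) s₁ (x₁ * x₂ / t) *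
        (x₁ * x₂ / t - 1) ^ n) := by
  set g := productArray n (separatedCoeff t s₁ s₂ r₁ r₂ n) with hgdef
  have hg : IsHeunArray t s₁ s₂ s₃ r₁ r₂ g := isHeunArray_productArray hr
    (fun l => separatedCoeff_eq_zero _ _ _ _ _ l n.lt_succ_self)
    (separatedCoeff_recurrence r₁ r₂ ht₀ ht₁ hs₁ hs₂ n)
  have hg0 : ∀ k, g k 0 = jacobiCoeff t s₂ (r₁ + r₂ - s₁) n k := fun k =>
    productArray_separatedCoeff_zero t s₁ s₂ r₁ r₂ n k
  have hfib : ∀ q : ℕ × ℕ, HasSum (fun k => structureConstant s₂ s₃ r₁ r₂ ht₀ hs₁ q.1 q.2 k *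
      (x₁ ^ q.1 * x₂ ^ q.2) * jacobiCoeff t s₂ (r₁ + r₂ - s₁) n k)
      (g q.1 q.2 * (x₁ ^ q.1 * x₂ ^ q.2)) := fun q => by
    refine ((hg.hasSum ht₀ hs₁ q.1 q.2).mul_right _).congr_fun fun k => ?_
    rw [hg0]
    ring
  -- Summing over k first gives the array entries, whose double series has the closed form.
  have htot := ((Equiv.prodAssoc ℕ ℕ ℕ).hasSum_iff.2 hsum.hasSum).prod_fiberwise hfib
  have hval := hasSum_productArray_separatedCoeff (s₂ := s₂) r₁ r₂ ht₀ ht₁ hs₁ n hx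
  rw [← htot.unique hval]
  exact hsum.hasSum

end Heun

end

theorem theorem5p3p1 (t s₁ s₂ s₃ r₁ r₂ : ℂ) (ht₀ : t ≠ 0) (ht₁ : t ≠ 1)
    (hr : r₁ + r₂ = s₁ + s₂ + s₃ - 1)
    (hs₁ : ∀ n : ℕ, s₁ ≠ -(n : ℂ))
    (hs₂ : ∀ n : ℕ, r₁ + r₂ - s₁ - s₃ + 1 ≠ -(n : ℂ))
    (hs₂₃ : ∀ n : ℕ, r₁ + r₂ - s₁ + 1 ≠ -(n : ℂ)) :
    ∃ ρ > (0 : ℝ), ∃ R > (0 : ℝ), ∀ x₁ x₂ y : ℂ, ‖x₁‖ < ρ → ‖x₂‖ < ρ → R < ‖y‖ →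
      ‖x₁ * x₂‖ < ‖t‖ ∧ ‖t - 1‖ < ‖y - 1‖ ∧
      Summable (Heun.kernelTerm s₂ s₃ r₁ r₂ ht₀ hs₁ x₁ x₂ y) ∧
      HasSum (fun i : ℕ =>
        1 / (y - 1) *
          ((∏ k ∈ Finset.Icc 1 i, (r₁ + r₂ - s₁ - s₃ + (k : ℂ))) /
            (∏ k ∈ Finset.Ico i (2 * i), (r₁ + r₂ - s₁ + (k : ℂ)))) *
          ordinaryHypergeometric ((i : ℂ) + 1) (r₁ + r₂ - s₁ - s₃ + (i : ℂ) + 1)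
            (r₁ + r₂ - s₁ + 2 * (i : ℂ) + 1) ((t - 1) / (y - 1)) *
          ordinaryHypergeometric (-(i : ℂ)) (r₁ + r₂ - s₁ + (i : ℂ)) (r₁ + r₂ - s₁ - s₃ + 1)
            (t * (x₁ - 1) * (x₂ - 1) / ((t - 1) * (x₁ * x₂ - t))) *
          ordinaryHypergeometric (r₁ + (i : ℂ)) (r₂ + (i : ℂ)) s₁ (x₁ * x₂ / t) *
          (x₁ * x₂ / t - 1) ^ i * ((t - 1) ^ i / (y - 1) ^ i))
        (Heun.kernel s₂ s₃ r₁ r₂ ht₀ hs₁ x₁ x₂ y) := by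
  have hbs : r₁ + r₂ - s₁ - s₃ + 1 = s₂ := by linear_combination hr
  have hb : ∀ n : ℕ, s₂ ≠ -(n : ℂ) := hbs ▸ hs₂
  obtain ⟨ρ, hρ, hC⟩ := Heun.exists_summable_structureConstant s₂ s₃ r₁ r₂ ht₀ hs₁
  obtain ⟨Q, hQ, hJ, hK⟩ := Heun.exists_hasSum_kernelCoeff ht₁ hb hs₂₃
  have hQ0 : 0 < Q := one_pos.trans_le hQ
  -- The bounds 1 and |t| give |x₁x₂| < |t|. From |y - 1| ≥ |y| - 1 > 1 + 4Q³|t-1| follow |y - 1| >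
  -- 1, |t - 1| < |y - 1| and the bound 1/4 of `exists_hasSum_kernelCoeff`.
  refine ⟨min ρ (min 1 ‖t‖), lt_min hρ (lt_min one_pos (norm_pos_iff.2 ht₀)),
    2 + 4 * (Q ^ 3 * ‖t - 1‖), by positivity, fun x₁ x₂ y hx₁ hx₂ hy => ?_⟩
  have hx : ‖x₁ * x₂‖ < ‖t‖ := by
    have h1 : ‖x₁‖ ≤ 1 := hx₁.le.trans ((min_le_right _ _).trans (min_le_left _ _))
    have h2 : ‖x₂‖ < ‖t‖ := hx₂.trans_le ((min_le_right _ _).trans (min_le_right _ _))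
    rw [norm_mul]
    exact (mul_le_of_le_one_left (norm_nonneg _) h1).trans_lt h2
  have hyn : ‖y‖ ≤ ‖y - 1‖ + 1 := by simpa using norm_add_le (y - 1) 1
  have htn : 0 ≤ Q ^ 3 * ‖t - 1‖ := by positivity
  have hy1 : 1 < ‖y - 1‖ := by linarith
  have hyt : ‖t - 1‖ < ‖y - 1‖ := by
    have : ‖t - 1‖ ≤ Q ^ 3 * ‖t - 1‖ := le_mul_of_one_le_left (norm_nonneg _) (one_le_pow₀ hQ)
    linarith
  have hv : Q ^ 3 * ‖(t - 1) / (y - 1)‖ ≤ 1 / 4 := by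
    rw [norm_div, mul_div_assoc', div_le_iff₀ (by linarith)]
    linarith
  obtain ⟨hE, hEsum⟩ := hK y hy1 hv
  have hCx := hC ‖x₁‖ ‖x₂‖ (norm_nonneg _) (norm_nonneg _) (hx₁.le.trans (min_le_left _ _))
    (hx₂.le.trans (min_le_left _ _))
  set d := r₁ + r₂ - s₁ with hd
  -- The final interchange: summing over n gives the terms of the kernel, summing over (i, j, k)
  -- gives the separated solutions.
  set F : (ℕ × ℕ × ℕ) × ℕ → ℂ := fun z =>
    Heun.structureConstant s₂ s₃ r₁ r₂ ht₀ hs₁ z.1.1 z.1.2.1 z.1.2.2 *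
      (x₁ ^ z.1.1 * x₂ ^ z.1.2.1) * (Heun.kernelCoeff t s₂ d y z.2 *
        Heun.jacobiCoeff t s₂ d z.2 z.1.2.2) with hF
  have hFsum : Summable F := Heun.summable_prod_mul (Q := Q)
    (C := fun p : ℕ × ℕ × ℕ => Heun.structureConstant s₂ s₃ r₁ r₂ ht₀ hs₁ p.1 p.2.1 p.2.2 *
      (x₁ ^ p.1 * x₂ ^ p.2.1)) (E := Heun.kernelCoeff t s₂ d y)
    (J := fun n p => Heun.jacobiCoeff t s₂ d n p.2.2) hQ0.le
    (hCx.congr fun p => by simp only [norm_mul, norm_pow]) hE fun n p => hJ n p.2.2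
  have hrow : ∀ p, HasSum (fun n => F (p, n)) (Heun.kernelTerm s₂ s₃ r₁ r₂ ht₀ hs₁ x₁ x₂ y p) :=
    fun p => (hEsum p.2.2).mul_left
      (Heun.structureConstant s₂ s₃ r₁ r₂ ht₀ hs₁ p.1 p.2.1 p.2.2 * (x₁ ^ p.1 * x₂ ^ p.2.1))
  have hcol : ∀ n, HasSum (fun p => F (p, n)) (Heun.kernelCoeff t s₂ d y n *
      (ordinaryHypergeometric (-(n : ℂ)) (d + n) s₂
          (t * (x₁ - 1) * (x₂ - 1) / ((t - 1) * (x₁ * x₂ - t))) *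
        ordinaryHypergeometric (r₁ + (n : ℂ)) (r₂ + (n : ℂ)) s₁ (x₁ * x₂ / t) *
        (x₁ * x₂ / t - 1) ^ n)) := fun n => by
    refine ((Heun.hasSum_structureConstant_mul_jacobiCoeff ht₀ ht₁ hr hs₁ hb n hx ?_).mul_left
      (Heun.kernelCoeff t s₂ d y n)).congr_fun fun p => ?_
    · refine Summable.of_norm_bounded (hCx.mul_right (Q ^ n)) fun p => ?_
      simp only [norm_mul, norm_pow]
      gcongr
      exact hJ _ _
    · simp only [hF]
      ring
  refine ⟨hx, hyt, ?_, ?_⟩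
  · exact (hFsum.hasSum.prod_fiberwise hrow).summable
  refine (Heun.hasSum_of_summable_prod hFsum hrow hcol).congr_fun fun n => ?_
  have hnum : ∏ k ∈ Finset.Icc 1 n, (d - s₃ + (k : ℂ)) = Heun.rising s₂ n := by
    rw [← Finset.Ico_add_one_right_eq_Icc, Finset.prod_Ico_eq_prod_range, Nat.add_sub_cancel,
      Heun.rising]
    refine Finset.prod_congr rfl fun k _ => ?_
    rw [← hbs]
    push_cast
    ring
  have hden : ∏ k ∈ Finset.Ico n (2 * n), (d + (k : ℂ)) = Heun.rising (d + n) n := by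
    rw [Finset.prod_Ico_eq_prod_range, Heun.rising, show 2 * n - n = n by omega]
    refine Finset.prod_congr rfl fun k _ => ?_
    push_cast
    ring
  rw [hnum, hden, hbs, show d - s₃ + (n : ℂ) + 1 = s₂ + n by linear_combination hbs,
    Heun.kernelCoeff]
  ring
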